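/- **Setting.** Let $d\ge 1$, let $\Omega\subset\mathbb{R}^d$ be a bounded open set with $\Omega\subset\{|x|\le r\}$ and such that $|\Omega|$ and the surface measure $|\partial\Omega|=\mathcal{H}^{d-1}(\partial\Omega)$ are positive and finite (for instance a bounded smooth domain). Let $f\in L^\infty(\Omega)$, $g\in L^\infty(\partial\Omega)$, $\alpha>0$. For the Poisson problem $-\Delta u=f$ in $\Omega$, $u=g$ on $\partial\Omega$, put $$\mathcal{L}(u)=\|-\Delta u-f\|_{L^2(\Omega)}^2+\alpha\|u-g\|_{L^2(\partial\Omega)}^2,$$ $$\widehat{\mathcal{L}}(u)=\frac{|\Omega|}{n}\sum_{i=1}^n|(-\Delta u-f)(X_i)|^2+\frac{\alpha|\partial\Omega|}{m}\sum_{j=1}^m|(u-g)(Y_j)|^2,$$ where $n,m\ge1$, the points $X_1,\dots,X_n$ are i.i.d. uniform on $\Omega$, and $Y_1,\dots,Y_m$ are i.i.d. uniform on $\partial\Omega$ (with respect to the surface measure). Let $\rho$ be $\tanh$ or the sigmoid $t\mapsto 1/(1+e^{-t})$. Let $\mathcal{U}=\mathcal{N}_\rho(L,\boldsymbol n_L,R)$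 be the class of functions $u_\theta:\mathbb{R}^d\to\mathbb{R}$ of the form $u^{(0)}=x$, $u^{(\ell)}=\rho(W^{(\ell)}u^{(\ell-1)}+b^{(\ell)})$ for $1\le\ell\le L-1$, $u_\theta=W^{(L)}u^{(L-1)}+b^{(L)}$, where the hidden widths are arbitrary, at most $\boldsymbol n_L$ of the entries of the weight matrices $W^{(\ell)}$ and bias vectors $b^{(\ell)}$ are nonzero, and all these entries are at most $R$ in absolute value. The statistical error is $$\mathcal{E}_{stat}=\sup_{u\in\mathcal{U}}|\mathcal{L}(u)-\widehat{\mathcal{L}}(u)|,\qquad\text{or}\qquad \mathcal{E}_{stat}=\sup_{u\in\mathcal{U}}[\mathcal{L}(u)-\widehat{\mathcal{L}}(u)]+\sup_{u\in\mathcal{U}}[\widehat{\mathcal{L}}(u)-\mathcal{L}(u)].$$ **Lemma.** For every $c_0>0$ there are $C>0$ and $k\in\mathbb{N}$, depending only on $c_0$, such that the following holds for all data as above with $2\le L\le c_0\log(d+3)$, $\boldsymbol n_L\ge1$, $R\ge1$ and $\boldsymbol n_L\,R\,\min(n,m)\ge2$. For each of the two versions of $\mathcal{E}_{stat}$, the suprema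 are finite, $\mathcal{E}_{stat}$ is an integrable random variable, and $$\mathbb{E}[\mathcal{E}_{stat}]\le c\Big[n^{-\frac12}\boldsymbol n_L^{4L-\frac72}R^{4L}\big(\log^{\frac12}R+\log^{\frac12}\boldsymbol n_L+\log^{\frac12}n\big)+m^{-\frac12}R^2\boldsymbol n_L^{\frac52}\big(\log^{\frac12}R+\log^{\frac12}\boldsymbol n_L+\log^{\frac12}m\big)\Big],$$ $$c=C\,\big(1+d+r+\|f\|_{L^\infty(\Omega)}+\|g\|_{L^\infty(\partial\Omega)}\big)^k\,\big(|\Omega|+\alpha|\partial\Omega|\big).$$ In particular, for fixed $\Omega$ and $\alpha$, the constant depends at most polynomially on $d$, $\|f\|_{L^\infty(\Omega)}$ and $\|g\|_{L^\infty(\partial\Omega)}$. -/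

import Mathlib

open MeasureTheory ProbabilityTheory
open scoped Matrix Laplacian ENNReal

noncomputable section

/-- Parameters (weights and biases) of a fully connected feedforward network of depth `L` with
input dimension `d` and scalar output. The layer widths are `width 0 = d, …, width L = 1`.
With the layers numbered from `1` to `L`, `W ℓ` and `b ℓ` are the weight matrix and the bias vector
of layer `ℓ + 1`; only the indices `ℓ < L` are ever used. -/
structure FeedforwardNet (d L : ℕ) where
  width : ℕ → ℕ
  width_zero : width 0 = d
  width_last : width L = 1
  W : ∀ ℓ : ℕ, Matrix (Fin (width (ℓ + 1))) (Fin (width ℓ)) ℝ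
  b : ∀ ℓ : ℕ, Fin (width (ℓ + 1)) → ℝ

namespace FeedforwardNet

variable {d L : ℕ}

/-- `layer θ ρ x ℓ` is the output of layer `ℓ` at the input `x`: layer `0` is the input itself, the
layers `1, …, L - 1` are affine maps followed by the activation `ρ`, and layer `L` is affine. -/
def layer (θ : FeedforwardNet d L) (ρ : ℝ → ℝ) (x : EuclideanSpace ℝ (Fin d)) :
    (ℓ : ℕ) → Fin (θ.width ℓ) → ℝ
  | 0 => fun i => x (Fin.cast θ.width_zero i)
  | ℓ + 1 => fun i =>
      if ℓ + 1 < L then ρ ((θ.W ℓ *ᵥ layer θ ρ x ℓ + θ.b ℓ) i)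
      else (θ.W ℓ *ᵥ layer θ ρ x ℓ + θ.b ℓ) i

/-- The function `u_θ : ℝᵈ → ℝ` computed by the network. -/
def realize (θ : FeedforwardNet d L) (ρ : ℝ → ℝ) (x : EuclideanSpace ℝ (Fin d)) : ℝ :=
  θ.layer ρ x L (Fin.cast θ.width_last.symm 0)

/-- The number of nonzero parameters (entries of weight matrices and of bias vectors). -/
def nnz (θ : FeedforwardNet d L) : ℕ :=
  ∑ ℓ ∈ Finset.range L,
    ((Finset.univ.filter fun p : Fin (θ.width (ℓ + 1)) × Fin (θ.width ℓ) =>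
        θ.W ℓ p.1 p.2 ≠ 0).card
      + (Finset.univ.filter fun i : Fin (θ.width (ℓ + 1)) => θ.b ℓ i ≠ 0).card)

/-- All parameters are bounded by `R` in absolute value. -/
def BoundedBy (θ : FeedforwardNet d L) (R : ℝ) : Prop :=
  ∀ ℓ < L, (∀ i j, |θ.W ℓ i j| ≤ R) ∧ ∀ i, |θ.b ℓ i| ≤ R

end FeedforwardNet

/-- The class of functions `ℝᵈ → ℝ` computed by networks with activation `ρ`, depth `L`, arbitrary
hidden widths, at most `N` nonzero parameters, and all parameters bounded by `R`. -/
def neuralClass (ρ : ℝ → ℝ) (d L N : ℕ) (R : ℝ) : Set (EuclideanSpace ℝ (Fin d) → ℝ) :=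
  {u | ∃ θ : FeedforwardNet d L, θ.nnz ≤ N ∧ θ.BoundedBy R ∧ u = θ.realize ρ}

/-- Surface measure on subsets of `ℝᵈ`: the `(d-1)`-dimensional Hausdorff measure, normalized so as
to agree with `(d-1)`-dimensional Lebesgue measure on hyperplanes (counting measure if `d = 1`). -/
def surfaceMeasure (d : ℕ) : Measure (EuclideanSpace ℝ (Fin d)) :=
  Measure.euclideanHausdorffMeasure (d - 1)

/-- The continuous loss
`‖-Δu - f‖²_{L²(Ω)} + α ‖u - g‖²_{L²(∂Ω)}` for the Poisson problem `-Δu = f`, `u = g` on `∂Ω`. -/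
def continuousLoss {d : ℕ} (Ω : Set (EuclideanSpace ℝ (Fin d))) (α : ℝ)
    (f g u : EuclideanSpace ℝ (Fin d) → ℝ) : ℝ :=
  (∫ x in Ω, (-(Δ u x) - f x) ^ 2)
    + α * ∫ y in frontier Ω, (u y - g y) ^ 2 ∂(surfaceMeasure d)

/-- The empirical (Monte Carlo) loss with interior points `x 0, …, x (n-1)` and boundary points
`y 0, …, y (m-1)`. -/
def empiricalLoss {d n m : ℕ} (Ω : Set (EuclideanSpace ℝ (Fin d))) (α : ℝ)
    (f g : EuclideanSpace ℝ (Fin d) → ℝ) (x : Fin n → EuclideanSpace ℝ (Fin d))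
    (y : Fin m → EuclideanSpace ℝ (Fin d)) (u : EuclideanSpace ℝ (Fin d) → ℝ) : ℝ :=
  volume.real Ω / n * ∑ i, (-(Δ u (x i)) - f (x i)) ^ 2
    + α * (surfaceMeasure d).real (frontier Ω) / m * ∑ j, (u (y j) - g (y j)) ^ 2

/-- `sup_{u ∈ U} |L(u) - L̂(u)|`. -/
def statError {V : Type*} (U : Set V) (loss empLoss : V → ℝ) : ℝ :=
  ⨆ u : U, |loss u - empLoss u|

/-- `sup_{u ∈ U} [L(u) - L̂(u)] + sup_{u ∈ U} [L̂(u) - L(u)]`. -/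
def statErrorTwoSided {V : Type*} (U : Set V) (loss empLoss : V → ℝ) : ℝ :=
  (⨆ u : U, (loss u - empLoss u)) + ⨆ u : U, (empLoss u - loss u)

/-- The `L^∞` norm (essential supremum of `|h|`) with respect to `μ`. -/
def supNorm {E : Type*} [MeasurableSpace E] (h : E → ℝ) (μ : Measure E) : ℝ :=
  (eLpNorm h ∞ μ).toReal

/-- The rate
`n^{-1/2} N^{4L-7/2} R^{4L} (√log R + √log N + √log n)
  + m^{-1/2} R² N^{5/2} (√log R + √log N + √log m)`. -/
def statRate (L N : ℕ) (R : ℝ) (n m : ℕ) : ℝ :=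
  (n : ℝ) ^ (-(1 / 2) : ℝ) * (N : ℝ) ^ (4 * (L : ℝ) - 7 / 2) * R ^ (4 * L)
      * (√(Real.log R) + √(Real.log N) + √(Real.log n))
    + (m : ℝ) ^ (-(1 / 2) : ℝ) * R ^ 2 * (N : ℝ) ^ (5 / 2 : ℝ)
      * (√(Real.log R) + √(Real.log N) + √(Real.log m))

end

/-! The proof is a covering argument at a single scale, combined with Hoeffding's inequality. After
normalisation, loss minus empirical loss is a weighted sum of two Monte Carlo errors, of `(-Δu -
f)²` on `Ω` and of `(u - g)²` on the boundary. For one fixed `u`, each is a centred mean of bounded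
i.i.d. variables, hence sub-Gaussian. Over `K` functions the expected maximum costs a factor of
order `√(log K)`. All other functions of the class are compared with the nearest of these `K`, at
distance `1/n` (or `1/m`), which is of lower order than the sampling error.

Two facts about the network class are needed.

Size. The widths are unbounded, but only `N` parameters are nonzero, so the network can be rewritten
as a list of `N` weighted edges among `N` hidden neurons (`FeedforwardNet.exists_edgeNet`).
Propagating a function together with its first two directional derivatives (its jet) gives `|Δu| ≤ d
· 16^L (NR)^{2L} / N²`. The gain `N⁻²` comes from the fact that at most one nonzero edge joins a
given input to a given neuron. Squaring this bound and multiplying by the `√N` from the entropy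
gives the power `N^{4L - 7/2}`. On the boundary only `|u| ≤ NR(1 + r)` is needed, because the
activation is bounded.

Entropy. Jets depend on the weights in a Lipschitz way, with a constant `Λ` that is doubly
exponential in `L`. Rounding the weights and recording the graph gives a finite cover
(`exists_cover_neuralClass`). Only `log Λ`, of order `3^L` times logarithms, enters the estimate.
Since `L ≤ c₀ log(d + 3)`, all factors exponential in `L` are polynomial in `d`
(`pow_le_pow_of_le_log`).

The supremum runs over an uncountable class. Its expectation is controlled by an explicit integrable
majorant (`exists_majorant_of_mgf_le`, `exists_majorant_monteCarloError`), and its measurability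
follows from a countable dense subfamily. -/

noncomputable section

/-! ### Sparse networks as lists of edges -/

/-- A network in sparse form: a list of `N` weighted edges between a constant neuron, `d` input
neurons, `N` hidden neurons and one output neuron (the target `none`). -/
structure EdgeNet (d N : ℕ) where
  tgt : Fin N → Option (Fin N)
  src : Fin N → Option (Fin d) ⊕ Fin N
  wt : Fin N → ℝ

namespace EdgeNet

variable {d N : ℕ} {A : Type*} [AddCommGroup A] [Module ℝ A]

/-- The affine combination received by the neuron `p`, given the values of all sources. -/
def recv (e : EdgeNet d N) (s : Option (Fin d) ⊕ Fin N → A) (p : Option (Fin N)) : A :=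
  ∑ k, if e.tgt k = p then e.wt k • s (e.src k) else 0

/-- The hidden neurons after `t` synchronous updates, started at zero. -/
def hid (e : EdgeNet d N) (F : A → A) (inp : Option (Fin d) → A) : ℕ → Fin N → A
  | 0 => fun _ => 0
  | t + 1 => fun p => F (e.recv (Sum.elim inp (hid e F inp t)) (some p))

/-- The output after `t` synchronous updates of the hidden neurons. -/
def out (e : EdgeNet d N) (F : A → A) (inp : Option (Fin d) → A) (t : ℕ) : A :=
  e.recv (Sum.elim inp (e.hid F inp t)) none

/-- No two edges of nonzero weight have the same source and the same target. -/
def Simple (e : EdgeNet d N) : Prop :=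
  ∀ k k', e.wt k ≠ 0 → e.wt k' ≠ 0 → e.src k = e.src k' → e.tgt k = e.tgt k' → k = k'

end EdgeNet

/-- The values of the constant neuron and of the input neurons at the point `x`. -/
def inputValue {d : ℕ} (x : EuclideanSpace ℝ (Fin d)) : Option (Fin d) → ℝ
  | none => 1
  | some i => x i

namespace FeedforwardNet

variable {d L : ℕ} (θ : FeedforwardNet d L)

/-- Positions of the parameters: a layer, a row, and a column (`none` for the bias). -/
abbrev Param : Type := Σ ℓ : Fin L, Fin (θ.width (ℓ + 1)) × Option (Fin (θ.width ℓ))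

/-- The value of a parameter. -/
def val : θ.Param → ℝ
  | ⟨ℓ, i, none⟩ => θ.b ℓ i
  | ⟨ℓ, i, some j⟩ => θ.W ℓ i j

lemma card_val_ne_zero : (Finset.univ.filter fun p : θ.Param => θ.val p ≠ 0).card = θ.nnz := by
  classical
  rw [Finset.card_filter, Fintype.sum_sigma, nnz, Finset.sum_range]
  refine Finset.sum_congr rfl fun ℓ _ => ?_
  rw [Finset.card_filter, Finset.card_filter, Fintype.sum_prod_type, Fintype.sum_prod_type,
    ← Finset.sum_add_distrib]
  refine Finset.sum_congr rfl fun i _ => ?_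
  rw [Fintype.sum_option, add_comm]
  rfl

/-- Neurons of all layers. -/
abbrev Neuron : Type := Σ ℓ : ℕ, Fin (θ.width ℓ)

/-- The source neuron of a parameter, if it is a weight. -/
def source : θ.Param → Option θ.Neuron
  | ⟨_, _, none⟩ => none
  | ⟨ℓ, _, some j⟩ => some ⟨ℓ, j⟩

/-- A neuron is read if some nonzero weight leaves it. -/
def IsRead (q : θ.Neuron) : Prop := ∃ p : θ.Param, θ.val p ≠ 0 ∧ θ.source p = some q

/-- A neuron that is read is the source of a nonzero parameter, and there are at most `N` such
parameters. Thus `N` names suffice whatever the widths are; the names of unread neurons are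
irrelevant. -/
lemma exists_injOn_isRead {N : ℕ} (hN : 1 ≤ N) (h : θ.nnz ≤ N) :
    ∃ ε : θ.Neuron → Fin N, Set.InjOn ε {q | θ.IsRead q} := by
  classical
  let T := (Finset.univ.filter fun p : θ.Param => θ.val p ≠ 0).image θ.source
  have hT : T.card ≤ N := (Finset.card_image_le.trans_eq θ.card_val_ne_zero).trans h
  have : Fintype.card T ≤ Fintype.card (Fin N) := by simpa using hT
  obtain ⟨ι⟩ := Function.Embedding.nonempty_of_card_le this
  refine ⟨fun q => if hq : some q ∈ T then ι ⟨some q, hq⟩ else ⟨0, hN⟩, ?_⟩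
  have key : ∀ q, θ.IsRead q → some q ∈ T := by
    rintro q ⟨p, hp, hq⟩
    exact Finset.mem_image.2 ⟨p, by simpa using hp, hq⟩
  intro q hq q' hq' hqq'
  simp only [key q hq, key q' hq', dif_pos] at hqq'
  simpa using ι.injective hqq'

/-- Relevant parameters: nonzero, and leading to the output or to a neuron that is read. -/
def Live (p : θ.Param) : Prop :=
  θ.val p ≠ 0 ∧ ((p.1 : ℕ) + 1 < L → θ.IsRead ⟨p.1 + 1, p.2.1⟩)

/-- The target of a parameter after the hidden neurons have been renamed by `ε`. -/
def edgeTgt {N : ℕ} (ε : θ.Neuron → Fin N) (p : θ.Param) : Option (Fin N) :=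
  if (p.1 : ℕ) + 1 < L then some (ε ⟨p.1 + 1, p.2.1⟩) else none

/-- The source of an edge leaving the neuron `q`. -/
def neuronSrc {N : ℕ} (ε : θ.Neuron → Fin N) : θ.Neuron → Option (Fin d) ⊕ Fin N
  | ⟨0, j⟩ => Sum.inl (some (Fin.cast θ.width_zero j))
  | ⟨ℓ + 1, j⟩ => Sum.inr (ε ⟨ℓ + 1, j⟩)

/-- The source of a parameter after the hidden neurons have been renamed by `ε`. -/
def edgeSrc {N : ℕ} (ε : θ.Neuron → Fin N) (p : θ.Param) : Option (Fin d) ⊕ Fin N :=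
  (θ.source p).elim (Sum.inl none) (θ.neuronSrc ε)

/-- Only live parameters become edges. A parameter feeding an unread hidden neuron does not affect
the output, and its target could share a name with a read neuron, so it must be dropped. Between
live parameters the renaming is faithful, which gives both simplicity and the correct sum at each
neuron. Unused edge slots get weight zero. -/
theorem exists_edgeNet {N : ℕ} {R : ℝ} (hN : 1 ≤ N) (hL : 1 ≤ L) (hR : 0 ≤ R) (h : θ.nnz ≤ N)
    (hb : θ.BoundedBy R) :
    ∃ e : EdgeNet d N, (∀ k, |e.wt k| ≤ R) ∧ e.Simple ∧
      ∀ (ρ : ℝ → ℝ) (x : EuclideanSpace ℝ (Fin d)),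
        θ.realize ρ x = e.out ρ (inputValue x) (L - 1) := by
  classical
  obtain ⟨ε, hε⟩ := θ.exists_injOn_isRead hN h
  have hcard : Fintype.card {p // θ.Live p} ≤ Fintype.card (Fin N) := by
    rw [Fintype.card_subtype, Fintype.card_fin]
    refine (Finset.card_le_card ?_).trans (θ.card_val_ne_zero.le.trans h)
    intro p hp
    simp only [Finset.mem_filter, Finset.mem_univ, true_and] at hp ⊢
    exact hp.1
  obtain ⟨ι⟩ := Function.Embedding.nonempty_of_card_le hcard
  let e : EdgeNet d N :=
    { tgt := Function.extend ι (fun p => θ.edgeTgt ε p) (fun _ => none)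
      src := Function.extend ι (fun p => θ.edgeSrc ε p) (fun _ => Sum.inl none)
      wt := Function.extend ι (fun p => θ.val p) (fun _ => 0) }
  have ht (p) : e.tgt (ι p) = θ.edgeTgt ε p :=
    ι.injective.extend_apply (fun p => θ.edgeTgt ε p) (fun _ => none) p
  have hs (p) : e.src (ι p) = θ.edgeSrc ε p :=
    ι.injective.extend_apply (fun p => θ.edgeSrc ε p) (fun _ => Sum.inl none) p
  have hw (p) : e.wt (ι p) = θ.val p :=
    ι.injective.extend_apply (fun p => θ.val p) (fun _ => 0) p
  have hw' (k) (hk : k ∉ Set.range ι) : e.wt k = 0 := by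
    simpa using Function.extend_apply' (f := ι) (fun p => θ.val p) (fun _ => 0) k
      (by simpa using hk)
  have hval : ∀ p, |θ.val p| ≤ R := by
    rintro ⟨ℓ, i, _ | j⟩
    · exact (hb ℓ ℓ.2).2 i
    · exact (hb ℓ ℓ.2).1 i j
  have hread : ∀ (ℓ : Fin L) i j, θ.W ℓ i j ≠ 0 → θ.IsRead ⟨ℓ, j⟩ :=
    fun ℓ i j hij => ⟨⟨ℓ, i, some j⟩, hij, rfl⟩
  -- two live parameters with the same target lie in the same row
  have hrow : ∀ p p' : θ.Param, θ.Live p → θ.Live p' → θ.edgeTgt ε p = θ.edgeTgt ε p' →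
      (⟨p.1, p.2.1⟩ : Σ ℓ : Fin L, Fin (θ.width (ℓ + 1))) = ⟨p'.1, p'.2.1⟩ := by
    rintro ⟨ℓ, i, o⟩ ⟨ℓ', i', o'⟩ ⟨-, h1⟩ ⟨-, h2⟩ heq
    simp only [edgeTgt] at heq h1 h2 ⊢
    split_ifs at heq with c1 c2 c2
    · have := hε (h1 c1) (h2 c2) (by simpa using heq)
      obtain ⟨ℓ, hℓ⟩ := ℓ
      obtain ⟨ℓ', hℓ'⟩ := ℓ'
      simp only [Sigma.mk.injEq, Nat.add_right_cancel_iff] at this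
      obtain ⟨rfl, h3⟩ := this
      simpa using h3
    · obtain ⟨ℓ, hℓ⟩ := ℓ
      obtain ⟨ℓ', hℓ'⟩ := ℓ'
      -- Both targets are the output, so both parameters lie in the last layer, which has a single
      -- row.
      have e1 : ℓ = L - 1 := by simp only at c1; omega
      have e2 : ℓ' = L - 1 := by simp only at c2; omega
      obtain rfl : ℓ = ℓ' := by omega
      have hw1 : θ.width (ℓ + 1) = 1 := by
        rw [show ℓ + 1 = L by omega]; exact θ.width_last
      simp only [Sigma.mk.injEq, heq_eq_eq, true_and]
      ext
      have := i.2; have := i'.2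
      simp only at *
      omega
  -- the input received along a row
  have hrecv : ∀ (s : Option (Fin d) ⊕ Fin N → ℝ) (ℓ : Fin L) (i : Fin (θ.width (ℓ + 1))),
      ((ℓ : ℕ) + 1 < L → θ.IsRead ⟨ℓ + 1, i⟩) →
      e.recv s (θ.edgeTgt ε ⟨ℓ, i, none⟩) =
        θ.b ℓ i * s (Sum.inl none) + ∑ j, θ.W ℓ i j * s (θ.neuronSrc ε ⟨ℓ, j⟩) := by
    intro s ℓ i hi
    have h1 : e.recv s (θ.edgeTgt ε ⟨ℓ, i, none⟩) =
        ∑ p : {p // θ.Live p}, if θ.edgeTgt ε p = θ.edgeTgt ε ⟨ℓ, i, none⟩ then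
          θ.val p * s (θ.edgeSrc ε p) else 0 := by
      symm
      refine Fintype.sum_of_injective ι ι.injective _ _ ?_ ?_
      · intro k hk
        simp [hw' k hk]
      · intro p
        simp only [ht, hs, hw, smul_eq_mul]
    have h2 : (∑ p : {p // θ.Live p}, if θ.edgeTgt ε p = θ.edgeTgt ε ⟨ℓ, i, none⟩ then
          θ.val p * s (θ.edgeSrc ε p) else 0) =
        ∑ p : θ.Param, if (⟨p.1, p.2.1⟩ : Σ ℓ : Fin L, Fin (θ.width (ℓ + 1))) = ⟨ℓ, i⟩ then
          θ.val p * s (θ.edgeSrc ε p) else 0 := by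
      refine Fintype.sum_of_injective Subtype.val Subtype.val_injective _ _ ?_ ?_
      · rintro p hp
        split_ifs with hpi
        · have : ¬ θ.Live p := by simpa using hp
          obtain ⟨ℓ', i', o⟩ := p
          simp only [Sigma.mk.injEq] at hpi
          obtain ⟨rfl, hpi⟩ := hpi
          obtain rfl := eq_of_heq hpi
          have : θ.val ⟨ℓ', i', o⟩ = 0 := by
            by_contra hne
            exact this ⟨hne, hi⟩
          simp [this]
        · rfl
      · rintro ⟨p, hp⟩
        refine if_congr ?_ rfl rfl
        constructor
        · intro hpt
          obtain ⟨ℓ', i', o⟩ := p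
          by_cases hc : (ℓ : ℕ) + 1 < L
          · simp only [edgeTgt, if_pos hc] at hpt
            split_ifs at hpt with c1
            have := hε (hp.2 c1) (hi hc) (by simpa using hpt)
            obtain ⟨ℓ, hℓ⟩ := ℓ
            obtain ⟨ℓ', hℓ'⟩ := ℓ'
            simp only [Sigma.mk.injEq, Nat.add_right_cancel_iff] at this
            obtain ⟨rfl, h3⟩ := this
            simpa using h3
          · simp only [edgeTgt, if_neg hc] at hpt
            split_ifs at hpt with c1
            obtain ⟨ℓ, hℓ⟩ := ℓ
            obtain ⟨ℓ', hℓ'⟩ := ℓ'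
            obtain rfl : ℓ' = ℓ := by simp only at c1 hc; omega
            have hw1 : θ.width (ℓ' + 1) = 1 := by
              rw [show ℓ' + 1 = L by simp only at c1; omega]; exact θ.width_last
            simp only [Sigma.mk.injEq, heq_eq_eq, true_and]
            ext
            have := i.2; have := i'.2
            simp only at *
            omega
        · intro hpi
          obtain ⟨ℓ', i', o⟩ := p
          simp only [Sigma.mk.injEq] at hpi
          obtain ⟨rfl, hpi⟩ := hpi
          obtain rfl := eq_of_heq hpi
          rfl
    rw [h1, h2, Fintype.sum_sigma, Finset.sum_eq_single ℓ, Fintype.sum_prod_type,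
      Finset.sum_eq_single i, Fintype.sum_option]
    · simp only [if_true]
      rfl
    · intro i' _ hne
      refine Finset.sum_eq_zero fun o _ => if_neg ?_
      simpa using hne
    · simp
    · intro ℓ' _ hne
      refine Finset.sum_eq_zero fun o _ => if_neg ?_
      intro h
      exact hne (congrArg Sigma.fst h)
    · simp
  refine ⟨e, ?_, ?_, ?_⟩
  · intro k
    by_cases hk : k ∈ Set.range ι
    · obtain ⟨p, rfl⟩ := hk
      rw [hw]
      exact hval p
    · rw [hw' k hk]
      simpa using hR
  · intro k k' hk hk' hsrc htgt
    obtain ⟨p, rfl⟩ : k ∈ Set.range ι := by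
      by_contra hc; exact hk (hw' k hc)
    obtain ⟨p', rfl⟩ : k' ∈ Set.range ι := by
      by_contra hc; exact hk' (hw' k' hc)
    rw [hs, hs] at hsrc
    rw [ht, ht] at htgt
    have hr := hrow p p' p.2 p'.2 htgt
    obtain ⟨⟨ℓ, i, o⟩, hp⟩ := p
    obtain ⟨⟨ℓ', i', o'⟩, hp'⟩ := p'
    simp only [Sigma.mk.injEq] at hr
    obtain ⟨rfl, hr⟩ := hr
    obtain rfl := eq_of_heq hr
    suffices o = o' by subst this; rfl
    obtain ⟨ℓ, hℓ⟩ := ℓ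
    rcases o with _ | j <;> rcases o' with _ | j'
    · rfl
    · rcases ℓ with _ | ℓ <;> simp [edgeSrc, source, neuronSrc] at hsrc
    · rcases ℓ with _ | ℓ <;> simp [edgeSrc, source, neuronSrc] at hsrc
    · rcases ℓ with _ | ℓ
      · simpa [edgeSrc, source, neuronSrc, Fin.ext_iff] using hsrc
      · have h3 := hε (hread ⟨ℓ + 1, hℓ⟩ i j hp.1) (hread ⟨ℓ + 1, hℓ⟩ i j' hp'.1)
          (by simpa [edgeSrc, source, neuronSrc] using hsrc)
        simpa using h3
  · intro ρ x
    have hsum : ∀ (s : Option (Fin d) ⊕ Fin N → ℝ) (ℓ : Fin L) (i : Fin (θ.width (ℓ + 1))),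
        ((ℓ : ℕ) + 1 < L → θ.IsRead ⟨ℓ + 1, i⟩) → s (Sum.inl none) = 1 →
        (∀ j, θ.IsRead ⟨ℓ, j⟩ → s (θ.neuronSrc ε ⟨ℓ, j⟩) = θ.layer ρ x ℓ j) →
        e.recv s (θ.edgeTgt ε ⟨ℓ, i, none⟩) = (θ.W ℓ *ᵥ θ.layer ρ x ℓ + θ.b ℓ) i := by
      intro s ℓ i hi h1 hj
      rw [hrecv s ℓ i hi, h1, mul_one, add_comm]
      simp only [Pi.add_apply, Matrix.mulVec, dotProduct]
      congr 1
      refine Finset.sum_congr rfl fun j _ => ?_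
      by_cases hz : θ.W ℓ i j = 0
      · simp [hz]
      · rw [hj j (hread ℓ i j hz)]
    -- The layers are forgotten in the edge list, so all hidden neurons are updated at once. A read
    -- neuron of layer `ℓ` has its final value from time `ℓ` on, since its sources lie in layer `ℓ -
    -- 1` and have settled one step before.
    have key : ∀ t : ℕ, ∀ ℓ : ℕ, ℓ ≤ t → ℓ < L → ∀ j, θ.IsRead ⟨ℓ, j⟩ →
        (Sum.elim (inputValue x) (e.hid ρ (inputValue x) t) : _ → ℝ) (θ.neuronSrc ε ⟨ℓ, j⟩) =
          θ.layer ρ x ℓ j := by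
      intro t
      induction t with
      | zero =>
        intro ℓ hℓ _ j _
        obtain rfl : ℓ = 0 := by omega
        rfl
      | succ t ih =>
        intro ℓ hℓt hℓ j hj
        rcases ℓ with _ | ℓ
        · rfl
        · have := hsum (Sum.elim (inputValue x) (e.hid ρ (inputValue x) t)) ⟨ℓ, by omega⟩ j
            (fun _ => hj) rfl (fun j' hj' => ih ℓ (by omega) (by omega) j' hj')
          simp only [edgeTgt, if_pos hℓ] at this
          simp only [neuronSrc, Sum.elim_inr, EdgeNet.hid, this, layer, if_pos hℓ]
    obtain ⟨L, rfl⟩ : ∃ L', L = L' + 1 := ⟨L - 1, by omega⟩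
    have := hsum (Sum.elim (inputValue x) (e.hid ρ (inputValue x) L)) ⟨L, by omega⟩
      (Fin.cast θ.width_last.symm 0) (fun h => by simp at h) rfl
      (fun j' hj' => key L L le_rfl (by omega) j' hj')
    simp only [edgeTgt, lt_irrefl, if_false] at this
    simp only [realize, layer, lt_irrefl, if_false, EdgeNet.out, Nat.add_sub_cancel]
    exact this.symm

end FeedforwardNet
end

/-! ### Activations and propagation of second order jets -/

noncomputable section

/-- An activation function with its first two derivatives, and the bounds used for them. -/
structure SmoothActivation (ρ ρ₁ ρ₂ : ℝ → ℝ) : Prop where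
  hasDerivAt : ∀ x, HasDerivAt ρ (ρ₁ x) x
  hasDerivAt₁ : ∀ x, HasDerivAt ρ₁ (ρ₂ x) x
  abs_le : ∀ x, |ρ x| ≤ 1
  abs_le₁ : ∀ x, |ρ₁ x| ≤ 1
  abs_le₂ : ∀ x, |ρ₂ x| ≤ 2
  abs_sub_le₂ : ∀ x y, |ρ₂ x - ρ₂ y| ≤ 6 * |x - y|

lemma abs_sub_le_of_hasDerivAt {f f' : ℝ → ℝ} {C : ℝ} (h : ∀ x, HasDerivAt f (f' x) x)
    (hC : ∀ x, |f' x| ≤ C) (x y : ℝ) : |f x - f y| ≤ C * |x - y| :=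
  convex_univ.norm_image_sub_le_of_norm_hasDerivWithin_le (f := f) (f' := f')
    (fun z _ => (h z).hasDerivWithinAt) (fun z _ => hC z) (Set.mem_univ y) (Set.mem_univ x)

lemma Real.hasDerivAt_tanh_sq (x : ℝ) : HasDerivAt Real.tanh (1 - Real.tanh x ^ 2) x := by
  have h := (Real.hasDerivAt_sinh x).div (Real.hasDerivAt_cosh x) (Real.cosh_pos x).ne'
  have e : Real.tanh = fun y => Real.sinh y / Real.cosh y := funext Real.tanh_eq_sinh_div_cosh
  rw [e]
  convert! h using 1
  field_simp [(Real.cosh_pos x).ne']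

lemma smoothActivation_tanh : SmoothActivation Real.tanh (fun x => 1 - Real.tanh x ^ 2)
    (fun x => -(2 * Real.tanh x * (1 - Real.tanh x ^ 2))) := by
  have h1 : ∀ x, Real.tanh x ^ 2 ≤ 1 := by
    intro x
    rw [Real.tanh_eq_sinh_div_cosh, div_pow, div_le_one (by positivity)]
    nlinarith [Real.cosh_sq x]
  have h2 : ∀ x, |Real.tanh x| ≤ 1 := fun x => by
    rw [← sq_le_one_iff_abs_le_one]; exact h1 x
  have hd : ∀ x, HasDerivAt (fun x => 1 - Real.tanh x ^ 2)
      (-(2 * Real.tanh x * (1 - Real.tanh x ^ 2))) x := by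
    intro x
    convert! ((Real.hasDerivAt_tanh_sq x).pow 2).const_sub 1 using 1
    norm_num
  refine ⟨Real.hasDerivAt_tanh_sq, hd, h2, fun x => ?_, fun x => ?_, ?_⟩
  · rw [abs_le]; constructor <;> nlinarith [h1 x, sq_nonneg (Real.tanh x)]
  · have := abs_le.1 (h2 x)
    rw [abs_le]; constructor <;> nlinarith [h1 x, sq_nonneg (Real.tanh x)]
  · refine abs_sub_le_of_hasDerivAt
      -- This is the third derivative of `tanh`; its bound is the Lipschitz constant of the second
      -- derivative.
      (f' := fun x => -(2 * (1 - Real.tanh x ^ 2) ^ 2 - 4 * Real.tanh x ^ 2 * (1 - Real.tanh x ^ 2)))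
      (fun x => ?_) (fun x => ?_)
    · convert! (((Real.hasDerivAt_tanh_sq x).const_mul 2).mul (hd x)).neg using 1
      ring
    · rw [abs_le]; constructor <;> nlinarith [h1 x, sq_nonneg (Real.tanh x),
        mul_nonneg (sq_nonneg (Real.tanh x)) (sub_nonneg.2 (h1 x))]

lemma smoothActivation_sigmoid : SmoothActivation Real.sigmoid
    (fun x => Real.sigmoid x * (1 - Real.sigmoid x))
    (fun x => Real.sigmoid x * (1 - Real.sigmoid x) * (1 - 2 * Real.sigmoid x)) := by
  have h0 := Real.sigmoid_nonneg
  have h1 := Real.sigmoid_le_one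
  have hb : ∀ x, 0 ≤ Real.sigmoid x * (1 - Real.sigmoid x) :=
    fun x => mul_nonneg (h0 x) (sub_nonneg.2 (h1 x))
  have hb' : ∀ x, Real.sigmoid x * (1 - Real.sigmoid x) ≤ 1 :=
    fun x => by nlinarith [h0 x, h1 x]
  have hd : ∀ x, HasDerivAt (fun x => Real.sigmoid x * (1 - Real.sigmoid x))
      (Real.sigmoid x * (1 - Real.sigmoid x) * (1 - 2 * Real.sigmoid x)) x := by
    intro x
    convert! (Real.hasDerivAt_sigmoid x).mul ((Real.hasDerivAt_sigmoid x).const_sub 1) using 1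
    ring
  refine ⟨Real.hasDerivAt_sigmoid, hd, fun x => ?_, fun x => ?_, fun x => ?_, ?_⟩
  · rw [abs_le]; constructor <;> linarith [h0 x, h1 x]
  · rw [abs_le]; constructor <;> linarith [hb x, hb' x]
  · rw [abs_le]; constructor <;> nlinarith [h0 x, h1 x, hb x, hb' x]
  · refine abs_sub_le_of_hasDerivAt
      (f' := fun x => Real.sigmoid x * (1 - Real.sigmoid x) * (1 - 2 * Real.sigmoid x) ^ 2
        - 2 * (Real.sigmoid x * (1 - Real.sigmoid x)) ^ 2)
      (fun x => ?_) (fun x => ?_)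
    · convert! (hd x).mul (((Real.hasDerivAt_sigmoid x).const_mul 2).const_sub 1) using 1
      ring
    · have h2 : (1 - 2 * Real.sigmoid x) ^ 2 ≤ 1 := by nlinarith [hb x]
      have h3 := hb x
      have h4 := hb' x
      rw [abs_le]
      constructor <;> nlinarith [mul_nonneg h3 (sq_nonneg (1 - 2 * Real.sigmoid x)),
        mul_le_mul_of_nonneg_left h2 h3, mul_le_mul_of_nonneg_left h4 h3,
        mul_nonneg h3 h3]

namespace SmoothActivation

variable {ρ ρ₁ ρ₂ : ℝ → ℝ}

lemma contDiff (h : SmoothActivation ρ ρ₁ ρ₂) : ContDiff ℝ 2 ρ := by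
  have e1 : deriv ρ = ρ₁ := funext fun x => (h.hasDerivAt x).deriv
  have e2 : deriv ρ₁ = ρ₂ := funext fun x => (h.hasDerivAt₁ x).deriv
  have hc : Continuous ρ₂ := by
    refine (LipschitzWith.of_dist_le_mul (K := 6) fun x y => ?_).continuous
    simpa [Real.dist_eq] using h.abs_sub_le₂ x y
  have h1 : ContDiff ℝ 1 ρ₁ := contDiff_one_iff_deriv.2
    ⟨fun x => (h.hasDerivAt₁ x).differentiableAt, by rwa [e2]⟩
  rw [show (2 : WithTop ℕ∞) = 1 + 1 by norm_num, contDiff_succ_iff_deriv]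
  exact ⟨fun x => (h.hasDerivAt x).differentiableAt, by simp, by rwa [e1]⟩

lemma abs_sub_le (h : SmoothActivation ρ ρ₁ ρ₂) (x y : ℝ) : |ρ x - ρ y| ≤ |x - y| := by
  simpa using abs_sub_le_of_hasDerivAt h.hasDerivAt h.abs_le₁ x y

lemma abs_sub_le₁ (h : SmoothActivation ρ ρ₁ ρ₂) (x y : ℝ) : |ρ₁ x - ρ₁ y| ≤ 2 * |x - y| :=
  abs_sub_le_of_hasDerivAt h.hasDerivAt₁ h.abs_le₂ x y

end SmoothActivation

section Jet

variable {E : Type*} [NormedAddCommGroup E] [NormedSpace ℝ E]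

/-- The value and the first two derivatives of `a` at `x` in the direction `v`. -/
def jet (v : E) (a : E → ℝ) (x : E) : ℝ × ℝ × ℝ :=
  (a x, fderiv ℝ a x v, fderiv ℝ (fun y => fderiv ℝ a y v) x v)

/-- The action of a function with derivatives `ρ₁`, `ρ₂` on second order jets. -/
def jetMap (ρ ρ₁ ρ₂ : ℝ → ℝ) (z : ℝ × ℝ × ℝ) : ℝ × ℝ × ℝ :=
  (ρ z.1, ρ₁ z.1 * z.2.1, ρ₂ z.1 * z.2.1 ^ 2 + ρ₁ z.1 * z.2.2)

lemma ContDiff.differentiable_fderiv_apply {a : E → ℝ} (ha : ContDiff ℝ 2 a) (v : E) :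
    Differentiable ℝ fun y => fderiv ℝ a y v :=
  ((ha.fderiv_right (m := 1) (by norm_num)).clm_apply contDiff_const).differentiable (by norm_num)

lemma fderiv_sum_smul_apply {ι : Type*} (s : Finset ι) (c : ι → ℝ) {a : ι → E → ℝ}
    (ha : ∀ i, Differentiable ℝ (a i)) (v x : E) :
    fderiv ℝ (fun y => ∑ i ∈ s, c i • a i y) x v = ∑ i ∈ s, c i • fderiv ℝ (a i) x v := by
  have h : HasFDerivAt (fun y => ∑ i ∈ s, c i • a i y) (∑ i ∈ s, c i • fderiv ℝ (a i) x) x :=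
    HasFDerivAt.fun_sum fun i _ => (ha i x).hasFDerivAt.const_smul (c i)
  rw [h.fderiv]
  simp

lemma jet_sum_smul {ι : Type*} (s : Finset ι) (c : ι → ℝ) (a : ι → E → ℝ)
    (ha : ∀ i, ContDiff ℝ 2 (a i)) (v x : E) :
    jet v (fun y => ∑ i ∈ s, c i • a i y) x = ∑ i ∈ s, c i • jet v (a i) x := by
  have h1 := fun y => fderiv_sum_smul_apply s c
    (fun i => (ha i).differentiable (by norm_num)) v y
  have h2 := fderiv_sum_smul_apply s c (fun i => (ha i).differentiable_fderiv_apply v) v x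
  simp only [jet, h1, h2]
  refine Prod.ext ?_ (Prod.ext ?_ ?_) <;> simp [Prod.fst_sum, Prod.snd_sum]

/-- The chain rule to second order in one direction: composition with `ρ` acts on jets pointwise
through `jetMap`, with no further information about `a`. -/
lemma jet_comp {ρ ρ₁ ρ₂ : ℝ → ℝ} (hρ : SmoothActivation ρ ρ₁ ρ₂) {a : E → ℝ}
    (ha : ContDiff ℝ 2 a) (v x : E) :
    jet v (fun y => ρ (a y)) x = jetMap ρ ρ₁ ρ₂ (jet v a x) := by
  have hd : Differentiable ℝ a := ha.differentiable (by norm_num)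
  have hd' := ha.differentiable_fderiv_apply v
  have h1 : ∀ y, fderiv ℝ (fun y => ρ (a y)) y v = ρ₁ (a y) * fderiv ℝ a y v := by
    intro y
    have := ((hρ.hasDerivAt (a y)).comp_hasFDerivAt y (hd y).hasFDerivAt).fderiv
    simp only [Function.comp_def] at this
    rw [this]
    rfl
  have h2 : HasFDerivAt (fun y => ρ₁ (a y)) (ρ₂ (a x) • fderiv ℝ a x) x :=
    (hρ.hasDerivAt₁ (a x)).comp_hasFDerivAt x (hd x).hasFDerivAt
  have h3 := (h2.mul (hd' x).hasFDerivAt).fderiv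
  simp only [jet, jetMap, h1]
  refine Prod.ext rfl (Prod.ext rfl ?_)
  change fderiv ℝ (fun y => ρ₁ (a y) * fderiv ℝ a y v) x v = _
  have h4 : (fun y => ρ₁ (a y) * fderiv ℝ a y v)
      = (fun y => ρ₁ (a y)) * fun y => fderiv ℝ a y v := rfl
  rw [h4, h3]
  simp only [_root_.add_apply, _root_.smul_apply, smul_eq_mul]
  ring

end Jet

namespace EdgeNet

variable {d N : ℕ} {ρ ρ₁ ρ₂ : ℝ → ℝ} {E : Type*} [NormedAddCommGroup E] [NormedSpace ℝ E]

lemma recv_eq_sum_smul {A : Type*} [AddCommGroup A] [Module ℝ A] (e : EdgeNet d N)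
    (s : Option (Fin d) ⊕ Fin N → A) (p : Option (Fin N)) :
    e.recv s p = ∑ k, (if e.tgt k = p then e.wt k else 0) • s (e.src k) := by
  simp only [recv, ite_smul, zero_smul]

lemma contDiff_recv (e : EdgeNet d N) {s : E → Option (Fin d) ⊕ Fin N → ℝ}
    (hs : ∀ q, ContDiff ℝ 2 fun x => s x q) (p : Option (Fin N)) :
    ContDiff ℝ 2 fun x => e.recv (s x) p := by
  simp only [recv_eq_sum_smul]
  exact ContDiff.sum fun k _ => contDiff_const.mul (hs _)

lemma jet_recv (e : EdgeNet d N) {s : E → Option (Fin d) ⊕ Fin N → ℝ}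
    (hs : ∀ q, ContDiff ℝ 2 fun x => s x q) (p : Option (Fin N)) (v x : E) :
    jet v (fun y => e.recv (s y) p) x = e.recv (fun q => jet v (fun y => s y q) x) p := by
  simp only [recv_eq_sum_smul]
  exact jet_sum_smul _ _ (fun k y => s y (e.src k)) (fun k => hs _) v x

lemma contDiff_elim {inp : E → Option (Fin d) → ℝ} {h : E → Fin N → ℝ}
    (hi : ∀ o, ContDiff ℝ 2 fun x => inp x o) (hh : ∀ p, ContDiff ℝ 2 fun x => h x p)
    (q : Option (Fin d) ⊕ Fin N) : ContDiff ℝ 2 fun x => (Sum.elim (inp x) (h x) : _ → ℝ) q := by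
  rcases q with q | q
  · exact hi q
  · exact hh q

/-- Taking jets commutes with linear combinations and turns `ρ` into `jetMap`. The jet of a network
is therefore the same network run on jets, which is why edge networks are defined over an arbitrary
real vector space of values. -/
lemma contDiff_hid_and_jet_hid (hρ : SmoothActivation ρ ρ₁ ρ₂) (e : EdgeNet d N)
    {inp : E → Option (Fin d) → ℝ} (hi : ∀ o, ContDiff ℝ 2 fun x => inp x o) (t : ℕ) :
    (∀ p, ContDiff ℝ 2 fun x => e.hid ρ (inp x) t p) ∧ ∀ p v x,
      jet v (fun y => e.hid ρ (inp y) t p) x =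
        e.hid (jetMap ρ ρ₁ ρ₂) (fun o => jet v (fun y => inp y o) x) t p := by
  induction t with
  | zero =>
    refine ⟨fun p => contDiff_const, fun p v x => ?_⟩
    simp [hid, jet]
  | succ t ih =>
    have hc := fun q => contDiff_elim hi ih.1 q
    refine ⟨fun p => hρ.contDiff.comp (e.contDiff_recv hc _), fun p v x => ?_⟩
    have h1 := jet_comp hρ (e.contDiff_recv hc (some p)) v x
    simp only [hid]
    rw [h1, e.jet_recv hc]
    congr 2
    funext q
    rcases q with q | q
    · rfl
    · exact ih.2 q v x

lemma contDiff_out (hρ : SmoothActivation ρ ρ₁ ρ₂) (e : EdgeNet d N)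
    {inp : E → Option (Fin d) → ℝ} (hi : ∀ o, ContDiff ℝ 2 fun x => inp x o) (t : ℕ) :
    ContDiff ℝ 2 fun x => e.out ρ (inp x) t :=
  e.contDiff_recv (fun q => contDiff_elim hi (e.contDiff_hid_and_jet_hid hρ hi t).1 q) none

lemma jet_out (hρ : SmoothActivation ρ ρ₁ ρ₂) (e : EdgeNet d N)
    {inp : E → Option (Fin d) → ℝ} (hi : ∀ o, ContDiff ℝ 2 fun x => inp x o) (t : ℕ) (v x : E) :
    jet v (fun y => e.out ρ (inp y) t) x =
      e.out (jetMap ρ ρ₁ ρ₂) (fun o => jet v (fun y => inp y o) x) t := by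
  have h := e.contDiff_hid_and_jet_hid hρ hi t
  simp only [out]
  rw [e.jet_recv fun q => contDiff_elim hi h.1 q]
  congr 1
  funext q
  rcases q with q | q
  · rfl
  · exact h.2 q v x

end EdgeNet

lemma laplacian_eq_sum_jet {d : ℕ} {u : EuclideanSpace ℝ (Fin d) → ℝ} (hu : ContDiff ℝ 2 u)
    (x : EuclideanSpace ℝ (Fin d)) :
    Δ u x = ∑ i, (jet (EuclideanSpace.basisFun (Fin d) ℝ i) u x).2.2 := by
  rw [InnerProductSpace.laplacian_eq_iteratedFDeriv_orthonormalBasis u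
    (EuclideanSpace.basisFun (Fin d) ℝ)]
  refine Finset.sum_congr rfl fun i _ => ?_
  set v := EuclideanSpace.basisFun (Fin d) ℝ i
  rw [iteratedFDeriv_two_apply]
  have h : DifferentiableAt ℝ (fderiv ℝ u) x :=
    (hu.fderiv_right (m := 1) (by norm_num)).differentiable (by norm_num) x
  simp only [jet]
  rw [fderiv_clm_apply h (differentiableAt_const v)]
  simp

lemma contDiff_inputValue {d : ℕ} (o : Option (Fin d)) :
    ContDiff ℝ 2 fun x : EuclideanSpace ℝ (Fin d) => inputValue x o := by
  rcases o with _ | i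
  · exact contDiff_const
  · exact (EuclideanSpace.proj i : EuclideanSpace ℝ (Fin d) →L[ℝ] ℝ).contDiff

lemma jet_inputValue {d : ℕ} (v x : EuclideanSpace ℝ (Fin d)) (o : Option (Fin d)) :
    jet v (fun y => inputValue y o) x = (inputValue x o, o.elim 0 fun i => v i, 0) := by
  rcases o with _ | i
  · simp [jet, inputValue]
  · have h : ∀ y, fderiv ℝ (fun y : EuclideanSpace ℝ (Fin d) => inputValue y (some i)) y v = v i := by
      intro y
      have := (EuclideanSpace.proj i : EuclideanSpace ℝ (Fin d) →L[ℝ] ℝ).hasFDerivAt (x := y)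
      have h2 := this.fderiv
      have h3 : (fun y : EuclideanSpace ℝ (Fin d) => inputValue y (some i)) =
        ⇑(EuclideanSpace.proj i : EuclideanSpace ℝ (Fin d) →L[ℝ] ℝ) := rfl
      rw [h3, h2]
      rfl
    simp [jet, h]

end

/-! ### Growth, Lipschitz dependence on the weights, and derivative bounds -/

noncomputable section

lemma Finset.sum_le_of_subsingleton_support {ι : Type*} (s : Finset ι) {f : ι → ℝ} {R : ℝ}
    (hR : 0 ≤ R) (hf : ∀ i, f i ≤ R) (h : ∀ i j, f i ≠ 0 → f j ≠ 0 → i = j) :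
    ∑ i ∈ s, f i ≤ R := by
  by_cases hi : ∃ i ∈ s, f i ≠ 0
  · obtain ⟨i, his, hi⟩ := hi
    rw [Finset.sum_eq_single_of_mem i his]
    · exact hf i
    · intro j _ hji
      by_contra hj
      exact hji (h j i hj hi)
  · push Not at hi
    rw [Finset.sum_eq_zero hi]
    exact hR

namespace EdgeNet

variable {d N : ℕ}

section Normed

variable {A : Type*} [NormedAddCommGroup A] [NormedSpace ℝ A]

lemma norm_recv_le {e : EdgeNet d N} {R B : ℝ} (hw : ∀ k, |e.wt k| ≤ R) (hR : 0 ≤ R)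
    {s : Option (Fin d) ⊕ Fin N → A} (hs : ∀ q, ‖s q‖ ≤ B) (p : Option (Fin N)) :
    ‖e.recv s p‖ ≤ N * R * B := by
  have : ∀ k, ‖if e.tgt k = p then e.wt k • s (e.src k) else 0‖ ≤ R * B := by
    intro k
    have hB : 0 ≤ B := (norm_nonneg _).trans (hs (e.src k))
    split_ifs
    · rw [norm_smul]
      exact mul_le_mul (hw k) (hs _) (norm_nonneg _) hR
    · simpa using mul_nonneg hR hB
  refine (norm_sum_le_of_le _ fun k _ => this k).trans ?_
  simp [mul_assoc]

lemma norm_recv_sub_le {e e' : EdgeNet d N} {R B D δ : ℝ} (hw' : ∀ k, |e'.wt k| ≤ R)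
    (hR : 0 ≤ R) (ht : e.tgt = e'.tgt) (hsrc : e.src = e'.src)
    (hδ : ∀ k, |e.wt k - e'.wt k| ≤ δ) {s s' : Option (Fin d) ⊕ Fin N → A}
    (hs : ∀ q, ‖s q‖ ≤ B) (hss : ∀ q, ‖s q - s' q‖ ≤ D) (p : Option (Fin N)) :
    ‖e.recv s p - e'.recv s' p‖ ≤ N * (δ * B + R * D) := by
  rw [recv, recv, ← Finset.sum_sub_distrib]
  refine (norm_sum_le_of_le _ (n := fun _ => δ * B + R * D) fun k _ => ?_).trans (by simp [mul_add])
  have hδ0 : 0 ≤ δ := (abs_nonneg _).trans (hδ k)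
  have hB : 0 ≤ B := (norm_nonneg _).trans (hs (e.src k))
  have hD : 0 ≤ D := (norm_nonneg _).trans (hss (e.src k))
  rw [ht, hsrc]
  split_ifs
  · have : e.wt k • s (e'.src k) - e'.wt k • s' (e'.src k) =
        (e.wt k - e'.wt k) • s (e'.src k) + e'.wt k • (s (e'.src k) - s' (e'.src k)) := by
      module
    rw [this]
    refine (norm_add_le _ _).trans (add_le_add ?_ ?_)
    · rw [norm_smul]
      exact mul_le_mul (hδ k) (hs _) (norm_nonneg _) hδ0
    · rw [norm_smul]
      exact mul_le_mul (hw' k) (hss _) (norm_nonneg _) hR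
  · simp only [sub_self, norm_zero]
    positivity

/-- Quadratic growth of `F` and of its Lipschitz constants. -/
structure QuadraticGrowth (F : A → A) (κ : ℝ) : Prop where
  norm_le : ∀ B : ℝ, 1 ≤ B → ∀ z, ‖z‖ ≤ B → ‖F z‖ ≤ κ * B ^ 2
  norm_sub_le : ∀ B : ℝ, 1 ≤ B → ∀ z z', ‖z‖ ≤ B → ‖z'‖ ≤ B → ‖F z - F z'‖ ≤ κ * B ^ 2 * ‖z - z'‖

variable {F : A → A} {κ R b : ℝ} {inp : Option (Fin d) → A}

/-- One update turns a bound `B` into `κ (NR B)² ≤ Λ B²`, where `Λ` is the base of the power. Since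
`2 · 3^t + 1 ≤ 3^(t+1)`, the exponent `3^t` reproduces itself. -/
lemma norm_elim_hid_le (hF : QuadraticGrowth F κ) (hκ : 2 ≤ κ) (hN : 1 ≤ N) (hR : 1 ≤ R)
    (hb : 1 ≤ b) (hinp : ∀ o, ‖inp o‖ ≤ b) {e : EdgeNet d N} (hw : ∀ k, |e.wt k| ≤ R) (t : ℕ)
    (q : Option (Fin d) ⊕ Fin N) :
    ‖(Sum.elim inp (e.hid F inp t) : _ → A) q‖ ≤ (κ * (N * R) ^ 2 * b) ^ 3 ^ t := by
  set Λ := κ * (N * R) ^ 2 * b with hΛ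
  have hN' : (1 : ℝ) ≤ N := by exact_mod_cast hN
  have hNR : 1 ≤ (N : ℝ) * R := one_le_mul_of_one_le_of_one_le hN' hR
  have hκNR : 1 ≤ κ * (N * R) ^ 2 :=
    one_le_mul_of_one_le_of_one_le (by linarith) (one_le_pow₀ hNR)
  have hΛ1 : 1 ≤ Λ := one_le_mul_of_one_le_of_one_le hκNR hb
  have hbΛ : b ≤ Λ := le_mul_of_one_le_left (by linarith) hκNR
  have hκΛ : κ * (N * R) ^ 2 ≤ Λ := le_mul_of_one_le_right (by linarith) hb
  induction t generalizing q with
  | zero =>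
    rcases q with o | p
    · simpa using (hinp o).trans hbΛ
    · simpa [hid] using zero_le_one.trans hΛ1
  | succ t ih =>
    rcases q with o | p
    · exact ((hinp o).trans hbΛ).trans (le_self_pow₀ hΛ1 (by positivity))
    · have h1 := norm_recv_le hw (by linarith) ih (some p)
      have h2 : 1 ≤ N * R * Λ ^ 3 ^ t :=
        one_le_mul_of_one_le_of_one_le hNR (one_le_pow₀ hΛ1)
      refine (hF.norm_le _ h2 _ h1).trans ?_
      calc κ * (N * R * Λ ^ 3 ^ t) ^ 2 = κ * (N * R) ^ 2 * Λ ^ (2 * 3 ^ t) := by ring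
        _ ≤ Λ * Λ ^ (2 * 3 ^ t) := by gcongr
        _ = Λ ^ (2 * 3 ^ t + 1) := by ring
        _ ≤ Λ ^ 3 ^ (t + 1) := by
          refine pow_le_pow_right₀ hΛ1 ?_
          have : 1 ≤ 3 ^ t := Nat.one_le_pow _ _ (by norm_num)
          omega

/-- At a neuron the difference of inputs comes from the changed weights and from the changed
sources; together they cost one factor `Λ`, because `2NR ≤ Λ`. The local Lipschitz constant of `F`
costs `Λ^(2·3^t + 1)`, and the total exponent `2·3^t + 3^(t+1) + 2` is at most `3^(t+2)`. The crude
double exponential is harmless because only its logarithm is used. -/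
lemma norm_elim_hid_sub_le (hF : QuadraticGrowth F κ) (hκ : 2 ≤ κ) (hN : 1 ≤ N) (hR : 1 ≤ R)
    (hb : 1 ≤ b) (hinp : ∀ o, ‖inp o‖ ≤ b) {e e' : EdgeNet d N} (hw : ∀ k, |e.wt k| ≤ R)
    (hw' : ∀ k, |e'.wt k| ≤ R) (ht : e.tgt = e'.tgt) (hsrc : e.src = e'.src) {δ : ℝ} (hδ0 : 0 ≤ δ)
    (hδ : ∀ k, |e.wt k - e'.wt k| ≤ δ) (t : ℕ) :
    (∀ q, ‖(Sum.elim inp (e.hid F inp t) : _ → A) q - (Sum.elim inp (e'.hid F inp t) : _ → A) q‖ ≤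
      (κ * (N * R) ^ 2 * b) ^ 3 ^ (t + 1) * δ) ∧
    ∀ p, ‖e.recv (Sum.elim inp (e.hid F inp t)) p - e'.recv (Sum.elim inp (e'.hid F inp t)) p‖ ≤
      (κ * (N * R) ^ 2 * b) ^ (3 ^ (t + 1) + 1) * δ := by
  have hs := norm_elim_hid_le hF hκ hN hR hb hinp hw
  have hs' := norm_elim_hid_le hF hκ hN hR hb hinp hw'
  set Λ := κ * (N * R) ^ 2 * b with hΛ
  have hN' : (1 : ℝ) ≤ N := by exact_mod_cast hN
  have hNR : 1 ≤ (N : ℝ) * R := one_le_mul_of_one_le_of_one_le hN' hR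
  have hκNR : 1 ≤ κ * (N * R) ^ 2 :=
    one_le_mul_of_one_le_of_one_le (by linarith) (one_le_pow₀ hNR)
  have hΛ1 : 1 ≤ Λ := one_le_mul_of_one_le_of_one_le hκNR hb
  have hκΛ : κ * (N * R) ^ 2 ≤ Λ := le_mul_of_one_le_right (by linarith) hb
  have h2NR : 2 * (N * R) ≤ Λ := by
    refine le_trans ?_ hκΛ
    have : (N : ℝ) * R ≤ (N * R) ^ 2 := le_self_pow₀ hNR (by norm_num)
    nlinarith
  have step : ∀ t, (∀ q, ‖(Sum.elim inp (e.hid F inp t) : _ → A) q -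
      (Sum.elim inp (e'.hid F inp t) : _ → A) q‖ ≤ Λ ^ 3 ^ (t + 1) * δ) →
      ∀ p, ‖e.recv (Sum.elim inp (e.hid F inp t)) p -
        e'.recv (Sum.elim inp (e'.hid F inp t)) p‖ ≤ Λ ^ (3 ^ (t + 1) + 1) * δ := by
    intro t ih p
    have h := norm_recv_sub_le hw' (by linarith) ht hsrc hδ (hs t) ih p
    refine h.trans ?_
    have h3 : Λ ^ 3 ^ t ≤ Λ ^ 3 ^ (t + 1) :=
      pow_le_pow_right₀ hΛ1 (Nat.pow_le_pow_right (by norm_num) (by omega))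
    calc N * (δ * Λ ^ 3 ^ t + R * (Λ ^ 3 ^ (t + 1) * δ))
        ≤ N * (δ * (R * Λ ^ 3 ^ (t + 1)) + R * (Λ ^ 3 ^ (t + 1) * δ)) := by
          gcongr
          exact h3.trans (le_mul_of_one_le_left (by positivity) hR)
      _ = 2 * (N * R) * Λ ^ 3 ^ (t + 1) * δ := by ring
      _ ≤ Λ * Λ ^ 3 ^ (t + 1) * δ := by gcongr
      _ = Λ ^ (3 ^ (t + 1) + 1) * δ := by ring
  suffices h : ∀ q, ‖(Sum.elim inp (e.hid F inp t) : _ → A) q -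
      (Sum.elim inp (e'.hid F inp t) : _ → A) q‖ ≤ Λ ^ 3 ^ (t + 1) * δ from ⟨h, step t h⟩
  induction t with
  | zero =>
    intro q
    have h0 : 0 ≤ Λ ^ 3 ^ (0 + 1) * δ := by positivity
    rcases q with o | p <;> simpa [hid] using h0
  | succ t ih =>
    intro q
    rcases q with o | p
    · have h0 : 0 ≤ Λ ^ 3 ^ (t + 1 + 1) * δ := by positivity
      simpa using h0
    · have h1 := norm_recv_le hw (by linarith) (hs t) (some p)
      have h1' := norm_recv_le hw' (by linarith) (hs' t) (some p)
      have h2 : 1 ≤ N * R * Λ ^ 3 ^ t :=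
        one_le_mul_of_one_le_of_one_le hNR (one_le_pow₀ hΛ1)
      refine (hF.norm_sub_le _ h2 _ _ h1 h1').trans ?_
      calc κ * (N * R * Λ ^ 3 ^ t) ^ 2 * ‖e.recv (Sum.elim inp (e.hid F inp t)) (some p) -
            e'.recv (Sum.elim inp (e'.hid F inp t)) (some p)‖
          ≤ κ * (N * R * Λ ^ 3 ^ t) ^ 2 * (Λ ^ (3 ^ (t + 1) + 1) * δ) := by
            gcongr
            exact step t ih (some p)
        _ = κ * (N * R) ^ 2 * Λ ^ (2 * 3 ^ t + 3 ^ (t + 1) + 1) * δ := by ring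
        _ ≤ Λ * Λ ^ (2 * 3 ^ t + 3 ^ (t + 1) + 1) * δ := by gcongr
        _ = Λ ^ (2 * 3 ^ t + 3 ^ (t + 1) + 2) * δ := by ring
        _ ≤ Λ ^ 3 ^ (t + 1 + 1) * δ := by
          refine mul_le_mul_of_nonneg_right (pow_le_pow_right₀ hΛ1 ?_) hδ0
          have : 1 ≤ 3 ^ t := Nat.one_le_pow _ _ (by norm_num)
          omega

end Normed

section Jets

variable {ρ ρ₁ ρ₂ : ℝ → ℝ}

/-- The worst component is the second derivative: its increment is at most `6DB² + 4DB + 2DB + D`,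
with `D` the distance of the jets, whence `13`. -/
lemma quadraticGrowth_jetMap (hρ : SmoothActivation ρ ρ₁ ρ₂) :
    QuadraticGrowth (jetMap ρ ρ₁ ρ₂) 13 := by
  have hn : ∀ {z : ℝ × ℝ × ℝ} {B : ℝ}, ‖z‖ ≤ B ↔ |z.1| ≤ B ∧ |z.2.1| ≤ B ∧ |z.2.2| ≤ B := by
    intro z B
    simp [Prod.norm_def]
  constructor
  · intro B hB z hz
    obtain ⟨h1, h2, h3⟩ := hn.1 hz
    have hBB : B ≤ B ^ 2 := le_self_pow₀ hB (by norm_num)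
    have e1 : |ρ₁ z.1| * |z.2.1| ≤ 1 * B := mul_le_mul (hρ.abs_le₁ _) h2 (abs_nonneg _) zero_le_one
    have e2 : |ρ₁ z.1| * |z.2.2| ≤ 1 * B := mul_le_mul (hρ.abs_le₁ _) h3 (abs_nonneg _) zero_le_one
    have e3 : |ρ₂ z.1| * |z.2.1| ^ 2 ≤ 2 * B ^ 2 :=
      mul_le_mul (hρ.abs_le₂ _) (pow_le_pow_left₀ (abs_nonneg _) h2 2) (by positivity) zero_le_two
    refine hn.2 ⟨?_, ?_, ?_⟩ <;> simp only [jetMap]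
    · nlinarith [hρ.abs_le z.1]
    · rw [abs_mul]; nlinarith
    · refine (abs_add_le _ _).trans ?_
      rw [abs_mul, abs_mul, abs_pow]
      nlinarith
  · intro B hB z z' hz hz'
    obtain ⟨h1, h2, h3⟩ := hn.1 hz
    obtain ⟨h1', h2', h3'⟩ := hn.1 hz'
    obtain ⟨g1, g2, g3⟩ := hn.1 (le_refl ‖z - z'‖)
    simp only [Prod.fst_sub, Prod.snd_sub] at g1 g2 g3
    set D := ‖z - z'‖
    have hD : 0 ≤ D := norm_nonneg _
    have hBB : B ≤ B ^ 2 := le_self_pow₀ hB (by norm_num)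
    have hBD : D ≤ B ^ 2 * D := le_mul_of_one_le_left hD (by linarith)
    have hBD' : B * D ≤ B ^ 2 * D := mul_le_mul_of_nonneg_right hBB hD
    have e0 : |ρ z.1 - ρ z'.1| ≤ D := (hρ.abs_sub_le _ _).trans g1
    have e1 : |ρ₁ z.1 - ρ₁ z'.1| ≤ 2 * D := (hρ.abs_sub_le₁ _ _).trans (by linarith)
    have e2 : |ρ₂ z.1 - ρ₂ z'.1| ≤ 6 * D := (hρ.abs_sub_le₂ _ _).trans (by linarith)
    have prod1 : ∀ c c' : ℝ, |c| ≤ B → |c - c'| ≤ D →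
        |ρ₁ z.1 * c - ρ₁ z'.1 * c'| ≤ 2 * D * B + D := by
      intro c c' hc hcc
      have : ρ₁ z.1 * c - ρ₁ z'.1 * c' = (ρ₁ z.1 - ρ₁ z'.1) * c + ρ₁ z'.1 * (c - c') := by ring
      rw [this]
      refine (abs_add_le _ _).trans (add_le_add ?_ ?_)
      · rw [abs_mul]
        exact mul_le_mul e1 hc (abs_nonneg _) (by positivity)
      · rw [abs_mul]
        exact (mul_le_mul (hρ.abs_le₁ _) hcc (abs_nonneg _) zero_le_one).trans_eq (one_mul D)
    refine hn.2 ⟨?_, ?_, ?_⟩ <;> simp only [jetMap, Prod.fst_sub, Prod.snd_sub]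
    · nlinarith
    · have := prod1 _ _ h2 g2
      nlinarith
    · have p1 := prod1 _ _ h3 g3
      have p2 : |ρ₂ z.1 * z.2.1 ^ 2 - ρ₂ z'.1 * z'.2.1 ^ 2| ≤ 6 * D * B ^ 2 + 2 * (D * (2 * B)) := by
        have : ρ₂ z.1 * z.2.1 ^ 2 - ρ₂ z'.1 * z'.2.1 ^ 2 = (ρ₂ z.1 - ρ₂ z'.1) * z.2.1 ^ 2
            + ρ₂ z'.1 * ((z.2.1 - z'.2.1) * (z.2.1 + z'.2.1)) := by ring
        rw [this]
        refine (abs_add_le _ _).trans (add_le_add ?_ ?_)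
        · rw [abs_mul, abs_pow]
          exact mul_le_mul e2 (pow_le_pow_left₀ (abs_nonneg _) h2 2) (by positivity) (by positivity)
        · rw [abs_mul, abs_mul]
          have : |z.2.1 + z'.2.1| ≤ 2 * B := (abs_add_le _ _).trans (by linarith)
          exact mul_le_mul (hρ.abs_le₂ _) (mul_le_mul g2 this (abs_nonneg _) hD) (by positivity)
            zero_le_two
      have : ρ₂ z.1 * z.2.1 ^ 2 + ρ₁ z.1 * z.2.2 - (ρ₂ z'.1 * z'.2.1 ^ 2 + ρ₁ z'.1 * z'.2.2) =
          (ρ₂ z.1 * z.2.1 ^ 2 - ρ₂ z'.1 * z'.2.1 ^ 2)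
            + (ρ₁ z.1 * z.2.2 - ρ₁ z'.1 * z'.2.2) := by ring
      rw [this]
      refine (abs_add_le _ _).trans ?_
      nlinarith

/-- The jets of the constant neuron and of the input neurons in a coordinate direction. -/
def inputJet (x : EuclideanSpace ℝ (Fin d)) (i : Fin d) (o : Option (Fin d)) : ℝ × ℝ × ℝ :=
  (inputValue x o, if o = some i then 1 else 0, 0)

lemma jet_out_basisFun (hρ : SmoothActivation ρ ρ₁ ρ₂) (e : EdgeNet d N) (t : ℕ)
    (x : EuclideanSpace ℝ (Fin d)) (i : Fin d) :
    jet (EuclideanSpace.basisFun (Fin d) ℝ i) (fun y => e.out ρ (inputValue y) t) x =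
      e.out (jetMap ρ ρ₁ ρ₂) (inputJet x i) t := by
  rw [jet_out hρ e contDiff_inputValue]
  congr 1
  funext o
  rw [jet_inputValue]
  rcases o with _ | j
  · rfl
  · simp [inputJet]

lemma abs_inputValue_le (x : EuclideanSpace ℝ (Fin d)) (o : Option (Fin d)) :
    |inputValue x o| ≤ 1 + ‖x‖ := by
  rcases o with _ | i
  · simp [inputValue]
  · have := PiLp.norm_apply_le x i
    simp only [inputValue]
    rw [← Real.norm_eq_abs]
    linarith

lemma norm_inputJet_le (x : EuclideanSpace ℝ (Fin d)) (i : Fin d) (o : Option (Fin d)) :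
    ‖inputJet x i o‖ ≤ 1 + ‖x‖ := by
  have h0 := norm_nonneg x
  simp only [inputJet, Prod.norm_def, Real.norm_eq_abs, sup_le_iff]
  refine ⟨abs_inputValue_le x o, ?_, by simpa using by linarith⟩
  split_ifs
  · simp
  · simpa using by linarith

variable {R : ℝ} {e : EdgeNet d N}

lemma recv_snd_fst (s : Option (Fin d) ⊕ Fin N → ℝ × ℝ × ℝ) (p : Option (Fin N)) :
    (e.recv s p).2.1 = e.recv (fun q => (s q).2.1) p := by
  simp only [recv_eq_sum_smul, Prod.fst_sum, Prod.snd_sum, Prod.smul_fst, Prod.smul_snd]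

lemma recv_snd_snd (s : Option (Fin d) ⊕ Fin N → ℝ × ℝ × ℝ) (p : Option (Fin N)) :
    (e.recv s p).2.2 = e.recv (fun q => (s q).2.2) p := by
  simp only [recv_eq_sum_smul, Prod.snd_sum, Prod.smul_snd]

/-- Among the inputs only coordinate `i` has a nonzero derivative, and simplicity leaves at most one
nonzero edge from it to `p`. The inputs thus contribute `R` rather than `NR`, which is the source of
the negative powers of `N` below. -/
lemma abs_recv_snd_fst_le (he : e.Simple) (hw : ∀ k, |e.wt k| ≤ R) (hR : 0 ≤ R)
    (x : EuclideanSpace ℝ (Fin d)) (i : Fin d) {h : Fin N → ℝ × ℝ × ℝ} {B : ℝ} (hB : 0 ≤ B)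
    (hh : ∀ p, |(h p).2.1| ≤ B) (p : Option (Fin N)) :
    |(e.recv (Sum.elim (inputJet x i) h) p).2.1| ≤ R + N * R * B := by
  classical
  rw [recv_snd_fst]
  have hk : ∀ k, ‖if e.tgt k = p then
      e.wt k • (Sum.elim (inputJet x i) h (e.src k) : ℝ × ℝ × ℝ).2.1 else 0‖ ≤
      (if e.tgt k = p ∧ e.src k = Sum.inl (some i) then |e.wt k| else 0) + R * B := by
    intro k
    have hRB : 0 ≤ R * B := mul_nonneg hR hB
    by_cases ht : e.tgt k = p
    · rcases hq : e.src k with o | q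
      · by_cases ho : o = some i
        · simp [ht, ho, inputJet, hRB]
        · simp [ht, ho, inputJet, hRB]
      · simp only [ht, if_true, Sum.elim_inr, smul_eq_mul, Real.norm_eq_abs, abs_mul]
        simpa using mul_le_mul (hw k) (hh q) (abs_nonneg _) hR
    · simp [ht, hRB]
  refine (norm_sum_le_of_le _ fun k _ => hk k).trans ?_
  rw [Finset.sum_add_distrib]
  refine add_le_add (Finset.sum_le_of_subsingleton_support _ hR (fun k => ?_) ?_) (by simp [mul_assoc])
  · split_ifs
    · exact hw k
    · exact hR
  · intro k k' hk hk'
    simp only [ne_eq, ite_eq_right_iff, abs_eq_zero, Classical.not_imp] at hk hk'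
    exact he k k' hk.2 hk'.2 (hk.1.2.trans hk'.1.2.symm) (hk.1.1.trans hk'.1.1.symm)

lemma abs_recv_snd_snd_le (hw : ∀ k, |e.wt k| ≤ R) (hR : 0 ≤ R)
    (x : EuclideanSpace ℝ (Fin d)) (i : Fin d) {h : Fin N → ℝ × ℝ × ℝ} {B : ℝ} (hB : 0 ≤ B)
    (hh : ∀ p, |(h p).2.2| ≤ B) (p : Option (Fin N)) :
    |(e.recv (Sum.elim (inputJet x i) h) p).2.2| ≤ N * R * B := by
  rw [recv_snd_snd]
  refine norm_recv_le (A := ℝ) hw hR (fun q => ?_) p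
  rcases q with o | q
  · simpa [inputJet] using hB
  · exact hh q

/-- First derivatives start with `R = NR/N` and grow by a factor `NR` per layer, so the gain `1/N`
persists. Second derivatives vanish at the inputs and are created only by the term `ρ₂ · (first
derivative)²`, which carries `1/N²`. The constants close because `8 · 4^t + 16^t ≤ 16^(t+1)`. -/
lemma abs_hid_jet_le (hρ : SmoothActivation ρ ρ₁ ρ₂) (he : e.Simple) (hw : ∀ k, |e.wt k| ≤ R)
    (hR : 1 ≤ R) (hN : 1 ≤ N) (x : EuclideanSpace ℝ (Fin d)) (i : Fin d) (t : ℕ) :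
    (∀ p, |(e.hid (jetMap ρ ρ₁ ρ₂) (inputJet x i) t p).2.1| ≤ (2 * (N * R)) ^ t / N) ∧
    ∀ p, |(e.hid (jetMap ρ ρ₁ ρ₂) (inputJet x i) t p).2.2| ≤
      16 ^ t * (N * R) ^ (2 * t) / (N : ℝ) ^ 2 := by
  have hN' : (1 : ℝ) ≤ N := by exact_mod_cast hN
  set y : ℝ := N * R with hy
  have hy1 : 1 ≤ y := one_le_mul_of_one_le_of_one_le hN' hR
  induction t with
  | zero =>
    constructor <;> intro p <;> simp [hid]
  | succ t ih =>
    have hz1 : ∀ p, |(e.recv (Sum.elim (inputJet x i)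
        (e.hid (jetMap ρ ρ₁ ρ₂) (inputJet x i) t)) p).2.1| ≤ (2 * y) ^ (t + 1) / N := by
      intro p
      refine (abs_recv_snd_fst_le he hw (by linarith) x i (by positivity) ih.1 p).trans ?_
      have : 1 ≤ (2 * y) ^ t := one_le_pow₀ (by linarith)
      rw [le_div_iff₀ (by linarith), ← hy]
      calc (R + y * ((2 * y) ^ t / N)) * N = y + y * (2 * y) ^ t := by
            rw [hy]; field_simp
        _ ≤ y * (2 * y) ^ t + y * (2 * y) ^ t := by
            gcongr; exact le_mul_of_one_le_right (by linarith) this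
        _ = (2 * y) ^ (t + 1) := by ring
    refine ⟨fun p => ?_, fun p => ?_⟩ <;> simp only [hid, jetMap]
    · rw [abs_mul]
      exact (mul_le_mul (hρ.abs_le₁ _) (hz1 _) (abs_nonneg _) zero_le_one).trans_eq (one_mul _)
    · have hz2 := abs_recv_snd_snd_le hw (by linarith) x i (by positivity) ih.2 (some p)
      refine (abs_add_le _ _).trans ?_
      rw [abs_mul, abs_mul, abs_pow]
      have e1 := mul_le_mul (hρ.abs_le₂ (e.recv (Sum.elim (inputJet x i)
        (e.hid (jetMap ρ ρ₁ ρ₂) (inputJet x i) t)) (some p)).1)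
        (pow_le_pow_left₀ (abs_nonneg _) (hz1 (some p)) 2) (by positivity) zero_le_two
      have e2 := (mul_le_mul (hρ.abs_le₁ (e.recv (Sum.elim (inputJet x i)
        (e.hid (jetMap ρ ρ₁ ρ₂) (inputJet x i) t)) (some p)).1) hz2 (abs_nonneg _) zero_le_one)
      refine (add_le_add e1 e2).trans ?_
      rw [← hy]
      have h16 : (4 : ℝ) ^ t ≤ 16 ^ t := pow_le_pow_left₀ (by norm_num) (by norm_num) t
      have hyt : y ^ (2 * t + 1) ≤ y ^ (2 * t + 2) := pow_le_pow_right₀ hy1 (by omega)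
      calc 2 * ((2 * y) ^ (t + 1) / N) ^ 2 + 1 * (y * (16 ^ t * y ^ (2 * t) / (N : ℝ) ^ 2))
          = (8 * 4 ^ t * y ^ (2 * t + 2) + 16 ^ t * y ^ (2 * t + 1)) / (N : ℝ) ^ 2 := by
            rw [show (4 : ℝ) ^ t = 2 ^ (2 * t) by rw [pow_mul]; norm_num]
            field_simp
            ring
        _ ≤ (8 * 16 ^ t * y ^ (2 * t + 2) + 16 ^ t * y ^ (2 * t + 2)) / (N : ℝ) ^ 2 := by gcongr
        _ = 9 * (16 ^ t * y ^ (2 * t + 2)) / (N : ℝ) ^ 2 := by ring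
        _ ≤ 16 * (16 ^ t * y ^ (2 * t + 2)) / (N : ℝ) ^ 2 := by gcongr; norm_num
        _ = 16 ^ (t + 1) * y ^ (2 * (t + 1)) / (N : ℝ) ^ 2 := by ring

lemma abs_laplacian_out_le (hρ : SmoothActivation ρ ρ₁ ρ₂) (he : e.Simple)
    (hw : ∀ k, |e.wt k| ≤ R) (hR : 1 ≤ R) (hN : 1 ≤ N) (x : EuclideanSpace ℝ (Fin d)) (t : ℕ) :
    |Δ (fun y => e.out ρ (inputValue y) t) x| ≤
      d * (16 ^ (t + 1) * (N * R) ^ (2 * (t + 1)) / (N : ℝ) ^ 2) := by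
  have hN' : (1 : ℝ) ≤ N := by exact_mod_cast hN
  have hy1 : 1 ≤ N * R := one_le_mul_of_one_le_of_one_le hN' hR
  rw [laplacian_eq_sum_jet (contDiff_out hρ e contDiff_inputValue t)]
  refine (Finset.abs_sum_le_sum_abs _ _).trans
    ((Finset.sum_le_card_nsmul _ _ (16 ^ (t + 1) * (N * R) ^ (2 * (t + 1)) / (N : ℝ) ^ 2)
      fun i _ => ?_).trans_eq (by simp))
  rw [jet_out_basisFun hρ]
  refine (abs_recv_snd_snd_le hw (by linarith) x i (by positivity)
    (abs_hid_jet_le hρ he hw hR hN x i t).2 none).trans ?_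
  rw [← mul_div_assoc]
  refine div_le_div_of_nonneg_right ?_ (by positivity)
  calc (N : ℝ) * R * (16 ^ t * (N * R) ^ (2 * t)) = 16 ^ t * (N * R) ^ (2 * t + 1) := by ring
    _ ≤ 16 ^ (t + 1) * (N * R) ^ (2 * (t + 1)) := by
      refine mul_le_mul (pow_le_pow_right₀ (by norm_num) (by omega))
        (pow_le_pow_right₀ hy1 (by omega)) (by positivity) (by positivity)

/-- Hidden values are at most `1`, so only the last affine map matters and the bound does not grow
with depth. -/
lemma abs_out_le (hρ : SmoothActivation ρ ρ₁ ρ₂) (hw : ∀ k, |e.wt k| ≤ R) (hR : 0 ≤ R)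
    (x : EuclideanSpace ℝ (Fin d)) (t : ℕ) :
    |e.out ρ (inputValue x) t| ≤ N * R * (1 + ‖x‖) := by
  refine norm_recv_le (A := ℝ) hw hR (fun q => ?_) none
  rcases q with o | p
  · exact abs_inputValue_le x o
  · have h0 := norm_nonneg x
    rcases t with _ | t
    · simp only [Sum.elim_inr, hid, norm_zero]; linarith
    · exact (hρ.abs_le _).trans (by linarith)

lemma norm_out_jet_sub_le (hρ : SmoothActivation ρ ρ₁ ρ₂) {e' : EdgeNet d N}
    (hw : ∀ k, |e.wt k| ≤ R) (hw' : ∀ k, |e'.wt k| ≤ R) (hR : 1 ≤ R) (hN : 1 ≤ N)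
    (ht : e.tgt = e'.tgt) (hsrc : e.src = e'.src) {δ : ℝ} (hδ0 : 0 ≤ δ)
    (hδ : ∀ k, |e.wt k - e'.wt k| ≤ δ) {r : ℝ} {x : EuclideanSpace ℝ (Fin d)} (hx : ‖x‖ ≤ r)
    (i : Fin d) (t : ℕ) :
    ‖e.out (jetMap ρ ρ₁ ρ₂) (inputJet x i) t - e'.out (jetMap ρ ρ₁ ρ₂) (inputJet x i) t‖ ≤
      (13 * (N * R) ^ 2 * (1 + r)) ^ 3 ^ (t + 2) * δ := by
  have hr : 0 ≤ r := (norm_nonneg x).trans hx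
  have hN' : (1 : ℝ) ≤ N := by exact_mod_cast hN
  have hNR : 1 ≤ (N : ℝ) * R := one_le_mul_of_one_le_of_one_le hN' hR
  have h := (norm_elim_hid_sub_le (quadraticGrowth_jetMap hρ) (by norm_num) hN hR
    (b := 1 + r) (by linarith) (fun o => (norm_inputJet_le x i o).trans (by linarith))
    hw hw' ht hsrc hδ0 hδ t).2 none
  refine h.trans ?_
  refine mul_le_mul_of_nonneg_right (pow_le_pow_right₀ ?_ ?_) hδ0
  · have : 1 ≤ (N * R) ^ 2 := one_le_pow₀ hNR
    nlinarith
  · have : 1 ≤ 3 ^ t := Nat.one_le_pow _ _ (by norm_num)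
    rw [show 3 ^ (t + 2) = 9 * 3 ^ t by ring, show 3 ^ (t + 1) = 3 * 3 ^ t by ring]
    omega

end Jets

end EdgeNet

/-! ### Bounds and finite covers of the network class -/

section Class

variable {d L N : ℕ} {R r : ℝ} {ρ ρ₁ ρ₂ : ℝ → ℝ}

lemma exists_edgeNet_of_mem_neuralClass (hN : 1 ≤ N) (hL : 1 ≤ L) (hR : 0 ≤ R)
    {u : EuclideanSpace ℝ (Fin d) → ℝ} (hu : u ∈ neuralClass ρ d L N R) :
    ∃ e : EdgeNet d N, (∀ k, |e.wt k| ≤ R) ∧ e.Simple ∧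
      u = fun x => e.out ρ (inputValue x) (L - 1) := by
  obtain ⟨θ, h1, h2, rfl⟩ := hu
  obtain ⟨e, he1, he2, he3⟩ := θ.exists_edgeNet hN hL hR h1 h2
  exact ⟨e, he1, he2, funext fun x => he3 ρ x⟩

lemma contDiff_of_mem_neuralClass (hρ : SmoothActivation ρ ρ₁ ρ₂) (hN : 1 ≤ N) (hL : 1 ≤ L)
    (hR : 0 ≤ R) {u : EuclideanSpace ℝ (Fin d) → ℝ} (hu : u ∈ neuralClass ρ d L N R) :
    ContDiff ℝ 2 u := by
  obtain ⟨e, -, -, rfl⟩ := exists_edgeNet_of_mem_neuralClass hN hL hR hu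
  exact e.contDiff_out hρ contDiff_inputValue _

lemma abs_le_of_mem_neuralClass (hρ : SmoothActivation ρ ρ₁ ρ₂) (hN : 1 ≤ N) (hL : 1 ≤ L)
    (hR : 0 ≤ R) {u : EuclideanSpace ℝ (Fin d) → ℝ} (hu : u ∈ neuralClass ρ d L N R)
    (x : EuclideanSpace ℝ (Fin d)) : |u x| ≤ N * R * (1 + ‖x‖) := by
  obtain ⟨e, he, -, rfl⟩ := exists_edgeNet_of_mem_neuralClass hN hL hR hu
  exact EdgeNet.abs_out_le hρ he hR x _

lemma abs_laplacian_le_of_mem_neuralClass (hρ : SmoothActivation ρ ρ₁ ρ₂) (hN : 1 ≤ N)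
    (hL : 1 ≤ L) (hR : 1 ≤ R) {u : EuclideanSpace ℝ (Fin d) → ℝ}
    (hu : u ∈ neuralClass ρ d L N R) (x : EuclideanSpace ℝ (Fin d)) :
    |Δ u x| ≤ d * (16 ^ L * (N * R) ^ (2 * L) / (N : ℝ) ^ 2) := by
  obtain ⟨e, he, hs, rfl⟩ := exists_edgeNet_of_mem_neuralClass hN hL (by linarith) hu
  have := EdgeNet.abs_laplacian_out_le hρ hs he hR hN x (L - 1)
  rwa [Nat.sub_add_cancel hL] at this

/-- The code of a function is the graph of a chosen edge network together with its weights rounded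
to a grid of step `δ`. Equal codes mean equal graphs and weights within `δ`, hence close jets. A
code, rather than a set of centres, is used so that representatives can later be taken inside the
class. -/
theorem exists_cover_neuralClass (hρ : SmoothActivation ρ ρ₁ ρ₂) (hd : 1 ≤ d) (hN : 1 ≤ N)
    (hL : 1 ≤ L) (hR : 1 ≤ R) (hr : 0 ≤ r) {η : ℝ} (hη : 0 < η) (hη1 : η ≤ 1) :
    ∃ (κ : Type) (_ : Fintype κ) (Φ : neuralClass ρ d L N R → κ),
      (Fintype.card κ : ℝ) ≤
        (30 * d ^ 2 * N ^ 2 * R * (13 * (N * R) ^ 2 * (1 + r)) ^ 3 ^ (L + 1) / η) ^ N ∧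
      ∀ u u', Φ u = Φ u' → ∀ x ∈ Metric.closedBall (0 : EuclideanSpace ℝ (Fin d)) r,
        |u.1 x - u'.1 x| ≤ η ∧ |Δ u.1 x - Δ u'.1 x| ≤ η := by
  choose e hw hs hu using fun u : neuralClass ρ d L N R =>
    exists_edgeNet_of_mem_neuralClass hN hL (by linarith) u.2
  have hN' : (1 : ℝ) ≤ N := by exact_mod_cast hN
  have hd' : (1 : ℝ) ≤ d := by exact_mod_cast hd
  have hNR : 1 ≤ (N : ℝ) * R := one_le_mul_of_one_le_of_one_le hN' hR
  set Λ := (13 * (N * R) ^ 2 * (1 + r)) ^ 3 ^ (L + 1) with hΛ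
  have hΛ1 : 1 ≤ Λ := by
    refine one_le_pow₀ ?_
    have : 1 ≤ (N * R) ^ 2 := one_le_pow₀ hNR
    nlinarith
  -- The factor `d` accounts for the Laplacian being a sum of `d` second derivatives, each
  -- controlled up to `Λ * δ`.
  set δ := η / (d * Λ) with hδ
  have hdΛ : 1 ≤ d * Λ := one_le_mul_of_one_le_of_one_le hd' hΛ1
  have hδ0 : 0 < δ := by positivity
  set m : ℕ := ⌈R / δ⌉₊ with hm
  have hmem : ∀ u k, ⌊(e u).wt k / δ⌋ ∈ Finset.Icc (-(m : ℤ)) m := by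
    intro u k
    have h1 := abs_le.1 (hw u k)
    have h2 : R / δ ≤ m := Nat.le_ceil _
    rw [Finset.mem_Icc]
    constructor
    · rw [Int.le_floor]
      push_cast
      have : -(R / δ) ≤ (e u).wt k / δ := by
        rw [← neg_div]
        exact div_le_div_of_nonneg_right h1.1 hδ0.le
      linarith
    · have h3 : (e u).wt k / δ ≤ m :=
        (div_le_div_of_nonneg_right h1.2 hδ0.le).trans h2
      exact_mod_cast (Int.floor_le _).trans h3
  refine ⟨(Fin N → Option (Fin N)) × (Fin N → Option (Fin d) ⊕ Fin N) ×
    (Fin N → Finset.Icc (-(m : ℤ)) m), inferInstance,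
    fun u => ((e u).tgt, (e u).src, fun k => ⟨_, hmem u k⟩), ?_, ?_⟩
  · have hcard : Fintype.card ((Fin N → Option (Fin N)) × (Fin N → Option (Fin d) ⊕ Fin N) ×
        (Fin N → Finset.Icc (-(m : ℤ)) m)) = ((N + 1) * ((d + 1 + N) * (2 * m + 1))) ^ N := by
      have : ((m : ℤ) + 1 + m).toNat = 2 * m + 1 := by omega
      simp [mul_pow, this]
    rw [hcard]
    push_cast
    refine pow_le_pow_left₀ (by positivity) ?_ N
    have hm1 : (m : ℝ) ≤ R / δ + 1 := (Nat.ceil_lt_add_one (by positivity)).le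
    have hRδ : R / δ = R * d * Λ / η := by rw [hδ]; field_simp
    have h1 : 1 ≤ R * d * Λ / η := by
      rw [le_div_iff₀ hη]
      have : 1 ≤ R * d * Λ := by
        rw [mul_assoc]; exact one_le_mul_of_one_le_of_one_le hR hdΛ
      linarith
    have h2 : (2 * m + 1 : ℝ) ≤ 5 * (R * d * Λ / η) := by linarith
    -- Targets, sources and rounded weights contribute the factors `2`, `3` and `5` of the constant
    -- `30`.
    calc ((N : ℝ) + 1) * ((d + 1 + N) * (2 * m + 1))
        ≤ (2 * N) * ((3 * (d * N)) * (5 * (R * d * Λ / η))) := by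
          gcongr
          · linarith
          · nlinarith
      _ = 30 * d ^ 2 * N ^ 2 * R * Λ / η := by ring
  · intro u u' huu x hx
    simp only [Prod.mk.injEq] at huu
    obtain ⟨ht, hsrc, hwt⟩ := huu
    have hclose : ∀ k, |(e u).wt k - (e u').wt k| ≤ δ := by
      intro k
      have h1 : ⌊(e u).wt k / δ⌋ = ⌊(e u').wt k / δ⌋ := congrArg Subtype.val (congrFun hwt k)
      have h2 := (Int.abs_sub_lt_one_of_floor_eq_floor h1).le
      rw [← sub_div, abs_div, abs_of_pos hδ0, div_le_one hδ0] at h2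
      exact h2
    have hxr : ‖x‖ ≤ r := by simpa using hx
    have hjet : ∀ i, ‖jet (EuclideanSpace.basisFun (Fin d) ℝ i) u.1 x
        - jet (EuclideanSpace.basisFun (Fin d) ℝ i) u'.1 x‖ ≤ Λ * δ := by
      intro i
      rw [hu u, hu u', EdgeNet.jet_out_basisFun hρ, EdgeNet.jet_out_basisFun hρ]
      have := EdgeNet.norm_out_jet_sub_le hρ (hw u) (hw u') hR hN ht hsrc hδ0.le hclose hxr i (L - 1)
      rwa [show L - 1 + 2 = L + 1 by omega] at this
    have hΛδ : d * (Λ * δ) = η := by rw [hδ]; field_simp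
    have hΛδ' : Λ * δ ≤ η := by
      rw [← hΛδ]
      exact le_mul_of_one_le_left (by positivity) hd'
    constructor
    -- The value is the first component of the jet in any direction; `1 ≤ d` provides one.
    · have := (norm_fst_le _).trans (hjet ⟨0, hd⟩)
      exact this.trans hΛδ'
    · have hc := fun u : neuralClass ρ d L N R =>
        contDiff_of_mem_neuralClass hρ hN hL (by linarith) u.2
      rw [laplacian_eq_sum_jet (hc u), laplacian_eq_sum_jet (hc u'), ← Finset.sum_sub_distrib]
      refine (Finset.abs_sum_le_sum_abs _ _).trans
        ((Finset.sum_le_card_nsmul _ _ (Λ * δ) fun i _ => ?_).trans_eq (by simpa using hΛδ))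
      exact ((norm_snd_le _).trans (norm_snd_le _)).trans (hjet i)

end Class

end

/-! ### Monte Carlo errors: concentration, uniform majorants, measurability -/

noncomputable section

/-- The difference between the mean of `φ` and its empirical mean over the points `x i`. -/
def monteCarloError {E : Type*} [MeasurableSpace E] (μ : Measure E) {n : ℕ} (φ : E → ℝ)
    (x : Fin n → E) : ℝ :=
  ∫ y, φ y ∂μ - (n : ℝ)⁻¹ * ∑ i, φ (x i)

/-- A maximal inequality for finite families of sub-Gaussian random variables, in the form of an
integrable majorant. -/
theorem exists_majorant_of_mgf_le {S : Type*} [MeasurableSpace S] {P : Measure S}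
    [IsProbabilityMeasure P] {κ : Type*} [Fintype κ] [Nonempty κ] {Z : κ → S → ℝ} {v : ℝ}
    (hv : 0 < v) (hint : ∀ c t, Integrable (fun s => Real.exp (t * Z c s)) P)
    (hmgf : ∀ c t, ∫ s, Real.exp (t * Z c s) ∂P ≤ Real.exp (v * t ^ 2 / 2)) :
    ∃ T : S → ℝ, Integrable T P ∧ (∀ c s, |Z c s| ≤ T s) ∧
      ∫ s, T s ∂P ≤ 2 * √(v * Real.log (2 * Fintype.card κ)) := by
  obtain ⟨K, hK⟩ : ∃ K : ℝ, K = Fintype.card κ := ⟨_, rfl⟩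
  have hK1 : 1 ≤ K := by
    have : 1 ≤ Fintype.card κ := Fintype.card_pos
    rw [hK]; exact_mod_cast this
  rw [← hK]
  set ℓ := Real.log (2 * K) with hℓ
  have hℓ0 : 0 < ℓ := Real.log_pos (by linarith)
  -- Up to a factor `√2` this minimises `(ℓ + v t²/2) / t`; the value attained is `3/2 · √(vℓ)`.
  set t := √ℓ / √v with ht
  have hsv : 0 < √v := Real.sqrt_pos.2 hv
  have hsl : 0 < √ℓ := Real.sqrt_pos.2 hℓ0
  have ht0 : 0 < t := div_pos hsl hsv
  set a := 2 * K * Real.exp (v * t ^ 2 / 2) with ha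
  have ha0 : 0 < a := by positivity
  have hlog : Real.log a = ℓ + v * t ^ 2 / 2 := by
    rw [ha, Real.log_mul (by positivity) (by positivity), Real.log_exp]
  let W : S → ℝ := fun s => ∑ c, (Real.exp (t * Z c s) + Real.exp (-t * Z c s))
  have hWint : Integrable W P := integrable_finsetSum _ fun c _ => (hint c t).add (hint c (-t))
  have hWle : ∫ s, W s ∂P ≤ a := by
    have h1 : ∫ s, W s ∂P = ∑ c, (∫ s, Real.exp (t * Z c s) ∂P + ∫ s, Real.exp (-t * Z c s) ∂P) := by
      refine (integral_finsetSum _ fun c _ => (hint c t).add (hint c (-t))).trans ?_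
      exact Finset.sum_congr rfl fun c _ => integral_add (hint c t) (hint c (-t))
    rw [h1]
    refine (Finset.sum_le_card_nsmul _ _ (2 * Real.exp (v * t ^ 2 / 2)) fun c _ => ?_).trans_eq ?_
    · have e1 := hmgf c t
      have e2 := hmgf c (-t)
      rw [neg_sq] at e2
      linarith
    · rw [ha, nsmul_eq_mul, Finset.card_univ, ← hK]; ring
  refine ⟨fun s => t⁻¹ * (W s / a + (Real.log a - 1)),
    ((hWint.div_const a).add (integrable_const _)).const_mul _, fun c s => ?_, ?_⟩
  · have h1 : Real.exp (t * |Z c s|) ≤ W s := by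
      have h2 : Real.exp (t * |Z c s|) ≤ Real.exp (t * Z c s) + Real.exp (-t * Z c s) := by
        rcases abs_cases (Z c s) with ⟨h, -⟩ | ⟨h, -⟩ <;> rw [h]
        · linarith [Real.exp_pos (-t * Z c s)]
        · rw [mul_neg, ← neg_mul]
          linarith [Real.exp_pos (t * Z c s)]
      exact h2.trans (Finset.single_le_sum (f := fun c => Real.exp (t * Z c s) +
        Real.exp (-t * Z c s)) (fun c _ => by positivity) (Finset.mem_univ c))
    -- The tangent line of the exponential at `log a` bounds `t|Z|` by an affine function of `W`.
    -- This replaces Jensen's inequality for the logarithm and makes the majorant visibly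
    -- integrable.
    have h3 := Real.add_one_le_exp (t * |Z c s| - Real.log a)
    rw [Real.exp_sub, Real.exp_log ha0] at h3
    have h4 : Real.exp (t * |Z c s|) / a ≤ W s / a := div_le_div_of_nonneg_right h1 ha0.le
    change |Z c s| ≤ t⁻¹ * (W s / a + (Real.log a - 1))
    rw [inv_mul_eq_div, le_div_iff₀ ht0]
    linarith
  · rw [integral_const_mul, integral_add (hWint.div_const a) (integrable_const _), integral_div,
      integral_const, probReal_univ, one_smul]
    have h1 : (∫ s, W s ∂P) / a ≤ 1 := (div_le_one ha0).2 hWle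
    have h2 : t⁻¹ * ((∫ s, W s ∂P) / a + (Real.log a - 1)) ≤ t⁻¹ * (ℓ + v * t ^ 2 / 2) := by
      refine mul_le_mul_of_nonneg_left ?_ (by positivity)
      linarith
    refine h2.trans ?_
    have h5 : v = √v ^ 2 := (Real.sq_sqrt hv.le).symm
    have h6 : ℓ = √ℓ ^ 2 := (Real.sq_sqrt hℓ0.le).symm
    rw [Real.sqrt_mul hv.le]
    have : t⁻¹ * (ℓ + v * t ^ 2 / 2) = 3 / 2 * (√v * √ℓ) := by
      rw [ht]
      nth_rewrite 2 [h6]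
      nth_rewrite 2 [h5]
      field_simp
      ring
    rw [this]
    have : 0 < √v * √ℓ := by positivity
    linarith

section Sampling

variable {E S : Type*} [MeasurableSpace E] [MeasurableSpace S] {μ : Measure E}
  {P : Measure S} {n : ℕ}
  {X : Fin n → S → E}

lemma aemeasurable_monteCarloError (hX : ∀ i, Measurable (X i)) (hlaw : ∀ i, P.map (X i) = μ)
    {φ : E → ℝ} (hφ : AEMeasurable φ μ) :
    AEMeasurable (fun s => monteCarloError μ φ fun i => X i s) P := by
  unfold monteCarloError
  refine AEMeasurable.const_sub (AEMeasurable.const_mul ?_ _) _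
  refine Finset.aemeasurable_fun_sum _ fun i _ => ?_
  exact AEMeasurable.comp_measurable (by rwa [hlaw i]) (hX i)

lemma ae_forall_mem_sample (hX : ∀ i, Measurable (X i)) (hlaw : ∀ i, P.map (X i) = μ)
    {p : E → Prop} (hp : ∀ᵐ x ∂μ, p x) : ∀ᵐ s ∂P, ∀ i, p (X i s) :=
  ae_all_iff.2 fun i => ae_of_ae_map (hX i).aemeasurable (by rwa [hlaw i])

/-- Hoeffding's lemma gives each summand the variance proxy `M²/4`; independence adds the proxies,
and the factor `1/n` leaves `M²/(4n)`. -/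
lemma mgf_monteCarloError_le [IsProbabilityMeasure P] (hn : 1 ≤ n) (hX : ∀ i, Measurable (X i)) (hind : iIndepFun X P)
    (hlaw : ∀ i, P.map (X i) = μ) {φ : E → ℝ} (hφ : AEMeasurable φ μ) {M : ℝ}
    (hφM : ∀ᵐ x ∂μ, φ x ∈ Set.Icc 0 M) (t : ℝ) :
    Integrable (fun s => Real.exp (t * monteCarloError μ φ fun i => X i s)) P ∧
      ∫ s, Real.exp (t * monteCarloError μ φ fun i => X i s) ∂P
        ≤ Real.exp (M ^ 2 / (4 * n) * t ^ 2 / 2) := by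
  have hn0 : (n : ℝ) ≠ 0 := by positivity
  have hφi : ∀ i, AEMeasurable φ (P.map (X i)) := fun i => by rwa [hlaw i]
  have hm : ∀ i, AEMeasurable (φ ∘ X i) P := fun i => (hφi i).comp_measurable (hX i)
  have hb : ∀ i, ∀ᵐ s ∂P, (φ ∘ X i) s ∈ Set.Icc 0 M := fun i =>
    ae_of_ae_map (hX i).aemeasurable (by rwa [hlaw i])
  have hmean : ∀ i, P[φ ∘ X i] = ∫ x, φ x ∂μ := by
    intro i
    rw [← hlaw i, integral_map (hX i).aemeasurable (hφi i).aestronglyMeasurable]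
    rfl
  have hsub : ∀ i ∈ Finset.univ, HasSubgaussianMGF (fun s => φ (X i s) - ∫ x, φ x ∂μ)
      ((‖M - 0‖₊ / 2) ^ 2) P := by
    intro i _
    have := hasSubgaussianMGF_of_mem_Icc (hm i) (hb i)
    rwa [hmean i] at this
  have hind' : iIndepFun (fun i s => φ (X i s) - ∫ x, φ x ∂μ) P :=
    hind.comp₀ (fun _ x => φ x - ∫ x, φ x ∂μ) (fun i => (hX i).aemeasurable)
      fun i => (hφi i).sub_const _
  have hsum := HasSubgaussianMGF.sum_of_iIndepFun hind' hsub
  have heq : (fun s => Real.exp (t * monteCarloError μ φ fun i => X i s)) =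
      fun s => Real.exp (-(t * (n : ℝ)⁻¹) * ∑ i, (φ (X i s) - ∫ x, φ x ∂μ)) := by
    funext s
    rw [Finset.sum_sub_distrib, monteCarloError]
    simp only [Finset.sum_const, Finset.card_univ, Fintype.card_fin, nsmul_eq_mul]
    congr 1
    field_simp
    ring
  rw [heq]
  refine ⟨hsum.integrable_exp_mul _, (hsum.mgf_le _).trans_eq ?_⟩
  push_cast
  simp only [Finset.sum_const, Finset.card_univ, Fintype.card_fin, nsmul_eq_mul, sub_zero,
    Real.norm_eq_abs, div_pow, sq_abs]
  congr 1
  field_simp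
  ring

section SquaredError

variable [IsProbabilityMeasure μ]

variable {ι : Type*} {ψ : ι → E → ℝ} {f : E → ℝ} {B F : ℝ} {D : Set E}

lemma abs_sub_sq_sub_sub_sq_le {a a' b B F η : ℝ} (ha : |a| ≤ B) (ha' : |a'| ≤ B) (hb : |b| ≤ F)
    (h : |a - a'| ≤ η) : |(a - b) ^ 2 - (a' - b) ^ 2| ≤ 2 * (B + F) * η := by
  have e : (a - b) ^ 2 - (a' - b) ^ 2 = (a + a' - 2 * b) * (a - a') := by ring
  have hη : 0 ≤ η := (abs_nonneg _).trans h
  rw [e, abs_mul]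
  refine mul_le_mul ?_ h (abs_nonneg _) ?_
  · rw [abs_le] at *
    constructor <;> linarith
  · linarith [(abs_nonneg _).trans ha, (abs_nonneg _).trans hb]

lemma sub_sq_mem_Icc {a b B F : ℝ} (ha : |a| ≤ B) (hb : |b| ≤ F) :
    (a - b) ^ 2 ∈ Set.Icc 0 ((B + F) ^ 2) := by
  refine ⟨sq_nonneg _, sq_le_sq' ?_ ?_⟩ <;> linarith [(abs_le.1 ha).1, (abs_le.1 ha).2, (abs_le.1 hb).1, (abs_le.1 hb).2]

/-- The exceptional set depends only on where the sample leaves `D` or violates the bound on `f`. It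
therefore serves all pairs `u`, `u'` at once, although the class is uncountable. -/
lemma ae_abs_monteCarloError_sub_le (hX : ∀ i, Measurable (X i)) (hlaw : ∀ i, P.map (X i) = μ)
    (hψ : ∀ u, Measurable (ψ u)) (hf : AEMeasurable f μ) (hD : ∀ᵐ x ∂μ, x ∈ D)
    (hfF : ∀ᵐ x ∂μ, |f x| ≤ F) (hB : ∀ u, ∀ x ∈ D, |ψ u x| ≤ B) :
    ∀ᵐ s ∂P, ∀ u u' η, 0 ≤ η → (∀ x ∈ D, |ψ u x - ψ u' x| ≤ η) →
      |monteCarloError μ (fun x => (ψ u x - f x) ^ 2) (fun i => X i s)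
        - monteCarloError μ (fun x => (ψ u' x - f x) ^ 2) (fun i => X i s)| ≤
        4 * (B + F) * η := by
  have hint : ∀ u, Integrable (fun x => (ψ u x - f x) ^ 2) μ := by
    intro u
    refine Integrable.of_mem_Icc 0 ((B + F) ^ 2) (((hψ u).aemeasurable.sub hf).pow_const 2) ?_
    filter_upwards [hD, hfF] with x h1 h2
    exact sub_sq_mem_Icc (hB u x h1) h2
  filter_upwards [ae_forall_mem_sample hX hlaw hD, ae_forall_mem_sample hX hlaw hfF]
    with s hs1 hs2 u u' η hη h
  have hpt : ∀ x, x ∈ D → |f x| ≤ F →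
      |(ψ u x - f x) ^ 2 - (ψ u' x - f x) ^ 2| ≤ 2 * (B + F) * η :=
    fun x h1 h2 => abs_sub_sq_sub_sub_sq_le (hB u x h1) (hB u' x h1) h2 (h x h1)
  have i1 : |∫ x, (ψ u x - f x) ^ 2 ∂μ - ∫ x, (ψ u' x - f x) ^ 2 ∂μ| ≤ 2 * (B + F) * η := by
    rw [← integral_sub (hint u) (hint u'), ← Real.norm_eq_abs]
    refine (norm_integral_le_of_norm_le_const (μ := μ) (C := 2 * (B + F) * η) ?_).trans_eq
      (by rw [probReal_univ, mul_one])
    filter_upwards [hD, hfF] with x h1 h2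
    exact hpt x h1 h2
  rcases Nat.eq_zero_or_pos n with rfl | hn
  · simp only [monteCarloError, Finset.univ_eq_empty, Finset.sum_empty, mul_zero, sub_zero]
    linarith [(abs_nonneg _).trans i1]
  have i2 : |(n : ℝ)⁻¹ * ∑ i, (ψ u (X i s) - f (X i s)) ^ 2
      - (n : ℝ)⁻¹ * ∑ i, (ψ u' (X i s) - f (X i s)) ^ 2| ≤ 2 * (B + F) * η := by
    rw [← mul_sub, ← Finset.sum_sub_distrib, abs_mul, abs_of_nonneg (by positivity),
      inv_mul_le_iff₀ (by positivity)]
    refine (Finset.abs_sum_le_sum_abs _ _).trans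
      ((Finset.sum_le_card_nsmul _ _ (2 * (B + F) * η) fun i _ => ?_).trans_eq (by simp))
    exact hpt _ (hs1 i) (hs2 i)
  simp only [monteCarloError]
  rw [abs_le] at *
  constructor <;> linarith

/-- Each function is replaced by the representative of its code, at a cost `4(B + F)η`. The finitely
many representatives obey the maximal inequality with `v = (B + F)⁴/(4n)`, for which `2√(v log)`
becomes `(B + F)² √(log / n)`. -/
theorem exists_majorant_monteCarloError [IsProbabilityMeasure P] [Nonempty ι] (hn : 1 ≤ n) (hX : ∀ i, Measurable (X i))
    (hind : iIndepFun X P) (hlaw : ∀ i, P.map (X i) = μ)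
    (hψ : ∀ u, Measurable (ψ u)) (hf : AEMeasurable f μ) (hD : ∀ᵐ x ∂μ, x ∈ D)
    (hfF : ∀ᵐ x ∂μ, |f x| ≤ F) (hB : ∀ u, ∀ x ∈ D, |ψ u x| ≤ B) (hB0 : 0 < B) (hF0 : 0 ≤ F)
    {κ : Type*} [Fintype κ] {Φ : ι → κ} {η : ℝ} (hη : 0 ≤ η)
    (hΦ : ∀ u u', Φ u = Φ u' → ∀ x ∈ D, |ψ u x - ψ u' x| ≤ η) :
    ∃ T : S → ℝ, Integrable T P ∧
      (∀ᵐ s ∂P, ∀ u, |monteCarloError μ (fun x => (ψ u x - f x) ^ 2) fun i => X i s| ≤ T s) ∧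
      ∫ s, T s ∂P ≤ 4 * (B + F) * η + (B + F) ^ 2 * √(Real.log (2 * Fintype.card κ) / n) := by
  classical
  have hn0 : (0 : ℝ) < n := by exact_mod_cast hn
  have hBF : 0 < B + F := by linarith
  have hφm : ∀ u, AEMeasurable (fun x => (ψ u x - f x) ^ 2) μ :=
    fun u => ((hψ u).aemeasurable.sub hf).pow_const 2
  have hφb : ∀ u, ∀ᵐ x ∂μ, (ψ u x - f x) ^ 2 ∈ Set.Icc 0 ((B + F) ^ 2) := by
    intro u
    filter_upwards [hD, hfF] with x h1 h2
    exact sub_sq_mem_Icc (hB u x h1) h2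
  have hmgf := fun u => mgf_monteCarloError_le hn hX hind hlaw (hφm u) (hφb u)
  -- Not every code need occur, so representatives are chosen only over the range of `Φ`.
  choose rep hrep using fun c : Set.range Φ => c.2
  obtain ⟨T, hT1, hT2, hT3⟩ := exists_majorant_of_mgf_le (P := P) (κ := Set.range Φ)
    (Z := fun c s => monteCarloError μ (fun x => (ψ (rep c) x - f x) ^ 2) fun i => X i s)
    (v := ((B + F) ^ 2) ^ 2 / (4 * n)) (by positivity) (fun c t => (hmgf (rep c) t).1)
    (fun c t => (hmgf (rep c) t).2)
  refine ⟨fun s => 4 * (B + F) * η + T s, (integrable_const _).add hT1, ?_, ?_⟩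
  · filter_upwards [ae_abs_monteCarloError_sub_le hX hlaw hψ hf hD hfF hB] with s hs u
    have h1 := hs u (rep ⟨Φ u, u, rfl⟩) η hη (hΦ _ _ (hrep ⟨Φ u, u, rfl⟩).symm)
    have h2 := hT2 ⟨Φ u, u, rfl⟩ s
    rw [abs_le] at *
    constructor <;> linarith
  · rw [integral_add (integrable_const _) hT1, integral_const, probReal_univ, one_smul]
    refine add_le_add le_rfl (hT3.trans ?_)
    have hc1 : (1 : ℝ) ≤ Fintype.card (Set.range Φ) := by exact_mod_cast Fintype.card_pos
    have hc2 : (Fintype.card (Set.range Φ) : ℝ) ≤ Fintype.card κ := by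
      exact_mod_cast set_fintype_card_le_univ _
    have hlog := Real.log_le_log (by linarith) (mul_le_mul_of_nonneg_left hc2 zero_le_two)
    have h4 : ((B + F) ^ 2) ^ 2 / (4 * n) * Real.log (2 * Fintype.card (Set.range Φ)) =
        ((B + F) ^ 2 / 2) ^ 2 * (Real.log (2 * Fintype.card (Set.range Φ)) / n) := by
      field_simp
      norm_num
    rw [h4, Real.sqrt_mul (by positivity), Real.sqrt_sq (by positivity)]
    rw [show ∀ y : ℝ, 2 * ((B + F) ^ 2 / 2 * y) = (B + F) ^ 2 * y by intro y; ring]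
    gcongr

end SquaredError

end Sampling

/-- Suprema of families that are approximated by a countable subfamily are measurable. -/
lemma aemeasurable_iSup_of_countable_approx {ι S : Type*} [MeasurableSpace S] {P : Measure S}
    [IsProbabilityMeasure P] {G : ι → S → ℝ} (hG : ∀ u, AEMeasurable (G u) P) {U₀ : Set ι}
    (hU : U₀.Countable) (h : ∀ᵐ s ∂P, ∀ u, ∀ ε > 0, ∃ u₀ ∈ U₀, |G u s - G u₀ s| ≤ ε)
    (hb : ∀ s, BddAbove (Set.range fun u => G u s)) :
    AEMeasurable (fun s => ⨆ u, G u s) P := by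
  have : Countable U₀ := hU.to_subtype
  refine (AEMeasurable.iSup fun u : U₀ => hG u).congr ?_
  filter_upwards [h] with s hs
  rcases isEmpty_or_nonempty ι with hι | hι
  · have : IsEmpty U₀ := ⟨fun u => hι.false u.1⟩
    rw [iSup_of_empty', iSup_of_empty']
  · have : Nonempty U₀ := by
      obtain ⟨u₀, hu₀, -⟩ := hs (Classical.arbitrary ι) 1 one_pos
      exact ⟨⟨u₀, hu₀⟩⟩
    have hb' : BddAbove (Set.range fun u : U₀ => G u s) :=
      (hb s).mono (by rintro _ ⟨u, rfl⟩; exact ⟨u, rfl⟩)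
    refine le_antisymm (ciSup_le fun u => le_ciSup (hb s) u.1) (ciSup_le fun u => ?_)
    refine le_of_forall_pos_le_add fun ε hε => ?_
    obtain ⟨u₀, hu₀, hle⟩ := hs u ε hε
    have := le_ciSup hb' ⟨u₀, hu₀⟩
    simp only at this
    linarith [(abs_le.1 hle).2]

end

/-! ### Uniform samples and integrability of the statistical error -/

noncomputable section

section Uniform

variable {E S : Type*} [MeasurableSpace E] [MeasurableSpace S] {P : Measure S}
  [IsProbabilityMeasure P] {ν : Measure E} {A : Set E} {Y : S → E}

lemma isProbabilityMeasure_cond_of_isUniform (hY : Measurable Y) (h : pdf.IsUniform Y A P ν) :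
    IsProbabilityMeasure (ProbabilityTheory.cond ν A) := by
  rw [pdf.IsUniform] at h
  rw [← h]
  exact Measure.isProbabilityMeasure_map hY.aemeasurable

/-- If `ν A` were zero or infinite, the normalised restriction would be the zero measure, which is
not the law of a random variable. -/
lemma measure_ne_zero_and_ne_top_of_isUniform (hY : Measurable Y) (h : pdf.IsUniform Y A P ν) :
    ν A ≠ 0 ∧ ν A ≠ ∞ := by
  have hp := isProbabilityMeasure_cond_of_isUniform hY h
  have h1 := hp.measure_univ
  constructor <;> intro h0 <;> rw [ProbabilityTheory.cond, h0] at h1 <;>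
    simp [h0] at h1

lemma ae_cond_of_ae_restrict {p : E → Prop} (h : ∀ᵐ x ∂ν.restrict A, p x) :
    ∀ᵐ x ∂ProbabilityTheory.cond ν A, p x :=
  Measure.ae_smul_measure h _

lemma real_mul_monteCarloError {n : ℕ} (h0 : ν A ≠ 0) (h1 : ν A ≠ ∞) (φ : E → ℝ)
    (x : Fin n → E) :
    ν.real A * monteCarloError (ProbabilityTheory.cond ν A) φ x =
      ∫ y in A, φ y ∂ν - ν.real A / n * ∑ i, φ (x i) := by
  have hr : ν.real A ≠ 0 := by
    rw [Measure.real, ENNReal.toReal_ne_zero]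
    exact ⟨h0, h1⟩
  rw [monteCarloError, ProbabilityTheory.cond, integral_smul_measure, ENNReal.toReal_inv, smul_eq_mul]
  change ν.real A * ((ν.real A)⁻¹ * _ - _) = _
  field_simp

lemma ae_abs_le_supNorm {f : E → ℝ} (hf : MemLp f ∞ ν) : ∀ᵐ x ∂ν, |f x| ≤ supNorm f ν := by
  filter_upwards [ae_le_eLpNormEssSup (f := f) (μ := ν)] with x hx
  rw [supNorm, ← Real.norm_eq_abs, ← toReal_enorm]
  refine ENNReal.toReal_mono hf.eLpNorm_ne_top ?_
  rwa [eLpNorm_exponent_top]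

end Uniform

/-- The approximating countable family gives measurability, and domination by `T` gives
integrability and the bound. In the second version each of the two suprema is at most `T`, whence
the factor `2`. -/
lemma integrable_statError_and_integral_le {V S : Type*} [MeasurableSpace S] {P : Measure S}
    [IsProbabilityMeasure P] {U : Set V} [Nonempty U] {loss : V → ℝ} {emp : S → V → ℝ}
    (hm : ∀ u : U, AEMeasurable (fun s => loss u - emp s u) P) {U₀ : Set U} (hU : U₀.Countable)
    (happ : ∀ᵐ s ∂P, ∀ u : U, ∀ ε > 0, ∃ u₀ ∈ U₀,
      |(loss u - emp s u) - (loss u₀ - emp s u₀)| ≤ ε)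
    (hb : ∀ s, BddAbove (Set.range fun u : U => |loss u - emp s u|))
    {T : S → ℝ} (hT : Integrable T P) (hle : ∀ᵐ s ∂P, ∀ u : U, |loss u - emp s u| ≤ T s) :
    (Integrable (fun s => statError U loss (emp s)) P ∧
      ∫ s, statError U loss (emp s) ∂P ≤ ∫ s, T s ∂P) ∧
    (Integrable (fun s => statErrorTwoSided U loss (emp s)) P ∧
      ∫ s, statErrorTwoSided U loss (emp s) ∂P ≤ 2 * ∫ s, T s ∂P) := by
  have hb1 : ∀ s, BddAbove (Set.range fun u : U => loss u - emp s u) := by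
    intro s
    obtain ⟨M, hM⟩ := hb s
    refine ⟨M, ?_⟩
    rintro _ ⟨u, rfl⟩
    exact (le_abs_self _).trans (hM ⟨u, rfl⟩)
  have hb2 : ∀ s, BddAbove (Set.range fun u : U => emp s u - loss u) := by
    intro s
    obtain ⟨M, hM⟩ := hb s
    refine ⟨M, ?_⟩
    rintro _ ⟨u, rfl⟩
    exact (le_abs_self _).trans ((abs_sub_comm _ _).le.trans (hM ⟨u, rfl⟩))
  have m0 : AEMeasurable (fun s => statError U loss (emp s)) P := by
    refine aemeasurable_iSup_of_countable_approx (fun u => (hm u).abs) hU ?_ hb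
    filter_upwards [happ] with s hs u ε hε
    obtain ⟨u₀, h0, h1⟩ := hs u ε hε
    exact ⟨u₀, h0, (abs_abs_sub_abs_le_abs_sub _ _).trans h1⟩
  have m1 : AEMeasurable (fun s => ⨆ u : U, (loss u - emp s u)) P :=
    aemeasurable_iSup_of_countable_approx hm hU happ hb1
  have m2 : AEMeasurable (fun s => ⨆ u : U, (emp s u - loss u)) P := by
    refine aemeasurable_iSup_of_countable_approx (fun u => ?_) hU ?_ hb2
    · refine (hm u).neg.congr (Filter.Eventually.of_forall fun s => ?_)
      simp
    · filter_upwards [happ] with s hs u ε hε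
      obtain ⟨u₀, h0, h1⟩ := hs u ε hε
      refine ⟨u₀, h0, ?_⟩
      rw [← abs_neg]
      convert h1 using 2
      ring
  have l0 : ∀ᵐ s ∂P, ‖statError U loss (emp s)‖ ≤ T s := by
    filter_upwards [hle] with s hs
    rw [Real.norm_eq_abs, statError, abs_of_nonneg (Real.iSup_nonneg fun u => abs_nonneg _)]
    exact ciSup_le hs
  have l1 : ∀ᵐ s ∂P, ‖statErrorTwoSided U loss (emp s)‖ ≤ 2 * T s := by
    filter_upwards [hle] with s hs
    have u : U := Classical.arbitrary U
    have a1 : ⨆ u : U, (loss u - emp s u) ≤ T s := ciSup_le fun u => (abs_le.1 (hs u)).2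
    have a2 : ⨆ u : U, (emp s u - loss u) ≤ T s :=
      ciSup_le fun u => by linarith [(abs_le.1 (hs u)).1]
    have a3 := le_ciSup (hb1 s) u
    have a4 := le_ciSup (hb2 s) u
    have a5 := abs_le.1 (hs u)
    rw [Real.norm_eq_abs, statErrorTwoSided, abs_le]
    constructor <;> linarith
  have i0 : Integrable (fun s => statError U loss (emp s)) P :=
    hT.mono' m0.aestronglyMeasurable l0
  have i1 : Integrable (fun s => statErrorTwoSided U loss (emp s)) P :=
    (hT.const_mul 2).mono' (m1.add m2).aestronglyMeasurable l1
  refine ⟨⟨i0, integral_mono_ae i0 hT ?_⟩, ⟨i1, ?_⟩⟩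
  · filter_upwards [l0] with s hs using (le_abs_self _).trans hs
  · rw [← integral_const_mul]
    refine integral_mono_ae i1 (hT.const_mul 2) ?_
    filter_upwards [l1] with s hs using (le_abs_self _).trans hs

/-! ### Elementary estimates -/

lemma Real.sqrt_add_le_sqrt_add_sqrt {a b : ℝ} (ha : 0 ≤ a) (hb : 0 ≤ b) :
    √(a + b) ≤ √a + √b := by
  rw [Real.sqrt_le_left (by positivity)]
  nlinarith [Real.sq_sqrt ha, Real.sq_sqrt hb, mul_nonneg (Real.sqrt_nonneg a) (Real.sqrt_nonneg b)]

/-- The logarithm of the cover size is `N` times a sum of logarithms, the one of the Lipschitz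
constant multiplied by `3^(L+1)`. Additive constants and the terms in `d` and `r` are absorbed into
the product `Q ℓ`, which is possible because `Q ≥ 2` and the sum `ℓ` of the three logarithms is at
least `1/2`. -/
lemma log_two_mul_card_le {d L N n : ℕ} {R r Q K : ℝ} (hd : 1 ≤ d) (hN : 1 ≤ N) (hR : 1 ≤ R)
    (hn : 1 ≤ n) (hr : 0 ≤ r) (hQ : 1 + d + r ≤ Q) (h2 : 2 ≤ N * R * n) (hK1 : 1 ≤ K)
    (hK : K ≤ (30 * d ^ 2 * N ^ 2 * R * (13 * (N * R) ^ 2 * (1 + r)) ^ 3 ^ (L + 1) / (1 / n)) ^ N) :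
    Real.log (2 * K) ≤ N * (256 * 3 ^ (L + 1) * Q *
      (Real.log R + Real.log N + Real.log n)) := by
  have hN' : (1 : ℝ) ≤ N := by exact_mod_cast hN
  have hd' : (1 : ℝ) ≤ d := by exact_mod_cast hd
  have hn' : (1 : ℝ) ≤ n := by exact_mod_cast hn
  set T := 3 ^ (L + 1) with hT
  have hT1 : (1 : ℝ) ≤ (T : ℝ) := by exact_mod_cast Nat.one_le_pow _ _ (by norm_num)
  have hTc : ((3 : ℝ) ^ (L + 1)) = (T : ℝ) := by rw [hT]; push_cast; rfl
  rw [hTc]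
  set q := 30 * (d : ℝ) ^ 2 * N ^ 2 * R * (13 * (N * R) ^ 2 * (1 + r)) ^ T / (1 / n) with hq
  have hqn : q = 30 * (d : ℝ) ^ 2 * N ^ 2 * R * (13 * (N * R) ^ 2 * (1 + r)) ^ T * n := by
    rw [hq, div_div_eq_mul_div, div_one]
  have hq0 : 0 < q := by rw [hqn]; positivity
  have h2K : 2 * K ≤ (2 * q) ^ N := by
    rw [mul_pow]
    have : (2 : ℝ) ≤ 2 ^ N := le_self_pow₀ (by norm_num) (by omega)
    exact mul_le_mul this hK (by linarith) (by positivity)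
  have hlog : Real.log (2 * K) ≤ N * Real.log (2 * q) := by
    rw [← Real.log_pow]
    exact Real.log_le_log (by linarith) h2K
  refine hlog.trans (mul_le_mul_of_nonneg_left ?_ (by positivity))
  have hexp : Real.log (2 * q) = Real.log 2 + Real.log 30 + 2 * Real.log d + 2 * Real.log N
      + Real.log R + T * (Real.log 13 + 2 * (Real.log N + Real.log R) + Real.log (1 + r))
      + Real.log n := by
    rw [hqn, Real.log_mul (by positivity) (by positivity), Real.log_mul (by positivity) (by positivity),
      Real.log_mul (by positivity) (by positivity), Real.log_mul (by positivity) (by positivity),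
      Real.log_mul (by positivity) (by positivity), Real.log_mul (by positivity) (by positivity),
      Real.log_pow, Real.log_pow, Real.log_pow, Real.log_mul (by positivity) (by positivity),
      Real.log_mul (by positivity) (by positivity), Real.log_pow,
      Real.log_mul (by positivity) (by positivity)]
    push_cast
    ring
  have l2 := Real.log_le_sub_one_of_pos (show (0 : ℝ) < 2 by norm_num)
  have l30 := Real.log_le_sub_one_of_pos (show (0 : ℝ) < 30 by norm_num)
  have l13 := Real.log_le_sub_one_of_pos (show (0 : ℝ) < 13 by norm_num)
  have ld := Real.log_le_sub_one_of_pos (show (0 : ℝ) < d by linarith)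
  have lr := Real.log_le_sub_one_of_pos (show (0 : ℝ) < 1 + r by linarith)
  have lN0 := Real.log_nonneg hN'
  have lR0 := Real.log_nonneg hR
  have ln0 := Real.log_nonneg hn'
  -- This is where `N R n ≥ 2` enters: without it all three logarithms could vanish.
  have hℓ : 1 / 2 ≤ Real.log R + Real.log N + Real.log n := by
    have h3 := Real.log_le_log (by norm_num) h2
    rw [Real.log_mul (by positivity) (by positivity), Real.log_mul (by positivity) (by positivity)]
      at h3
    linarith [Real.log_two_gt_d9]
  set ℓ := Real.log R + Real.log N + Real.log n with hℓdef
  have hQ2 : 2 ≤ Q := by linarith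
  rw [hexp]
  have e1 : Real.log 2 + Real.log 30 + 2 * Real.log d + 2 * Real.log N
      + Real.log R + Real.log n ≤ 32 + 2 * Q + 2 * ℓ := by linarith
  have e2 : Real.log 13 + 2 * (Real.log N + Real.log R) + Real.log (1 + r) ≤ 12 + Q + 2 * ℓ := by
    linarith
  have e3 : (T : ℝ) * (Real.log 13 + 2 * (Real.log N + Real.log R) + Real.log (1 + r)) ≤
      T * (12 + Q + 2 * ℓ) := mul_le_mul_of_nonneg_left e2 (by linarith)
  have e4 : 32 + 2 * Q + 2 * ℓ ≤ T * (32 + 2 * Q + 2 * ℓ) :=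
    le_mul_of_one_le_left (by linarith) hT1
  have e5 : 44 + 3 * Q + 4 * ℓ ≤ 256 * Q * ℓ := by
    have : Q ≤ 2 * (Q * ℓ) := by nlinarith
    have : 2 * ℓ ≤ Q * ℓ := by nlinarith
    linarith
  have e6 : (T : ℝ) * (44 + 3 * Q + 4 * ℓ) ≤ T * (256 * Q * ℓ) :=
    mul_le_mul_of_nonneg_left e5 (by linarith)
  calc _ ≤ (T : ℝ) * (44 + 3 * Q + 4 * ℓ) := by linarith
    _ ≤ T * (256 * Q * ℓ) := e6
    _ = 256 * T * Q * ℓ := by ring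

/-- The entropy term contributes `16 = √256` and the discretisation error `4/n` contributes `4`. The
square root of `3^(L+1) Q` is bounded by the number itself, which keeps the powers integral. -/
lemma sqrt_log_card_div_add_le {d L N n : ℕ} {R r Q K : ℝ} (hd : 1 ≤ d) (hN : 1 ≤ N) (hR : 1 ≤ R)
    (hn : 1 ≤ n) (hr : 0 ≤ r) (hQ : 1 + d + r ≤ Q) (h2 : 2 ≤ N * R * n) (hK1 : 1 ≤ K)
    (hK : K ≤ (30 * d ^ 2 * N ^ 2 * R * (13 * (N * R) ^ 2 * (1 + r)) ^ 3 ^ (L + 1) / (1 / n)) ^ N) :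
    4 * (1 / n) + √(Real.log (2 * K) / n) ≤
      20 * 3 ^ (L + 1) * Q * ((n : ℝ) ^ (-(1 / 2) : ℝ) * √N *
        (√(Real.log R) + √(Real.log N) + √(Real.log n))) := by
  have hN' : (1 : ℝ) ≤ N := by exact_mod_cast hN
  have hd' : (1 : ℝ) ≤ d := by exact_mod_cast hd
  have hn' : (1 : ℝ) ≤ n := by exact_mod_cast hn
  have hQ2 : 2 ≤ Q := by linarith
  have hlog := log_two_mul_card_le hd hN hR hn hr hQ h2 hK1 hK
  set T : ℝ := 3 ^ (L + 1) with hT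
  have hT1 : 1 ≤ T := one_le_pow₀ (by norm_num)
  have lN0 := Real.log_nonneg hN'
  have lR0 := Real.log_nonneg hR
  have ln0 := Real.log_nonneg hn'
  set s := √(Real.log R) + √(Real.log N) + √(Real.log n) with hs
  have hℓs : √(Real.log R + Real.log N + Real.log n) ≤ s :=
    (Real.sqrt_add_le_sqrt_add_sqrt (by positivity) ln0).trans
      (add_le_add_left (Real.sqrt_add_le_sqrt_add_sqrt lR0 lN0) _)
  have hs2 : 1 / 2 ≤ s := by
    refine le_trans ?_ hℓs
    refine Real.le_sqrt_of_sq_le ?_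
    have h3 := Real.log_le_log (by norm_num) h2
    rw [Real.log_mul (by positivity) (by positivity), Real.log_mul (by positivity) (by positivity)]
      at h3
    linarith [Real.log_two_gt_d9]
  have hnr : (n : ℝ) ^ (-(1 / 2) : ℝ) = (√n)⁻¹ := by
    rw [Real.rpow_neg (by positivity), ← Real.sqrt_eq_rpow]
  have hsn : 1 ≤ √(n : ℝ) := by rw [← Real.sqrt_one]; exact Real.sqrt_le_sqrt hn'
  have hsN : 1 ≤ √(N : ℝ) := by rw [← Real.sqrt_one]; exact Real.sqrt_le_sqrt hN'
  rw [hnr]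
  have hQT : 1 ≤ T * Q := by nlinarith
  have a1 : 1 / (n : ℝ) ≤ (√n)⁻¹ := by
    rw [one_div]
    refine inv_anti₀ (by positivity) ?_
    nlinarith [Real.sq_sqrt (show (0 : ℝ) ≤ n by positivity)]
  have a2 : √(Real.log (2 * K) / n) ≤ (√n)⁻¹ * (√N * (16 * (T * Q) * s)) := by
    rw [Real.sqrt_div' _ (by positivity), div_eq_inv_mul]
    refine mul_le_mul_of_nonneg_left ?_ (by positivity)
    refine (Real.sqrt_le_sqrt hlog).trans ?_
    rw [Real.sqrt_mul (by positivity)]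
    refine mul_le_mul_of_nonneg_left ?_ (by positivity)
    rw [show 256 * T * Q * (Real.log R + Real.log N + Real.log n) =
      (16 ^ 2 * (T * Q)) * (Real.log R + Real.log N + Real.log n) by ring,
      Real.sqrt_mul (by positivity), Real.sqrt_mul (by positivity), Real.sqrt_sq (by norm_num)]
    refine mul_le_mul (mul_le_mul_of_nonneg_left ?_ (by norm_num)) hℓs (by positivity)
      (by positivity)
    rw [Real.sqrt_le_left (by positivity)]
    exact le_self_pow₀ hQT (by norm_num)
  have a3 : 4 * (1 / (n : ℝ)) ≤ (√n)⁻¹ * (√N * (4 * (T * Q) * s)) := by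
    have : 1 ≤ √N * ((T * Q) * s) := by
      refine one_le_mul_of_one_le_of_one_le hsN ?_
      have : 2 ≤ T * Q := by nlinarith
      nlinarith
    calc 4 * (1 / (n : ℝ)) ≤ 4 * (√n)⁻¹ := by linarith
      _ = (√n)⁻¹ * 4 * 1 := by ring
      _ ≤ (√n)⁻¹ * 4 * (√N * ((T * Q) * s)) := mul_le_mul_of_nonneg_left this (by positivity)
      _ = _ := by ring
  refine (add_le_add a3 a2).trans_eq ?_
  ring

end

/-! ### Assembling the estimate -/

noncomputable section

lemma continuous_laplacian {d : ℕ} {u : EuclideanSpace ℝ (Fin d) → ℝ} (hu : ContDiff ℝ 2 u) :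
    Continuous (Δ u) := by
  rw [InnerProductSpace.laplacian_eq_iteratedFDeriv_orthonormalBasis u
    (EuclideanSpace.basisFun (Fin d) ℝ)]
  refine continuous_finsetSum _ fun i _ => ?_
  have h : Continuous (iteratedFDeriv ℝ 2 u) := hu.continuous_iteratedFDeriv le_rfl
  exact (ContinuousMultilinearMap.apply ℝ (fun _ : Fin 2 => EuclideanSpace ℝ (Fin d)) ℝ _).continuous.comp h

lemma neuralClass_nonempty {ρ : ℝ → ℝ} {d L N : ℕ} {R : ℝ} (hL : 1 ≤ L) (hR : 0 ≤ R) :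
    Nonempty (neuralClass ρ d L N R) := by
  let θ : FeedforwardNet d L :=
    { width := fun ℓ => if ℓ = 0 then d else 1
      width_zero := by simp
      width_last := by simp [show L ≠ 0 by omega]
      W := fun _ => 0
      b := fun _ => 0 }
  refine ⟨⟨θ.realize ρ, θ, ?_, ?_, rfl⟩⟩
  · have : θ.nnz = 0 := Finset.sum_eq_zero fun ℓ _ => by
      rw [Finset.filter_false_of_mem fun p _ h => h rfl,
        Finset.filter_false_of_mem fun i _ h => h rfl]
      rfl
    omega
  · intro ℓ _
    exact ⟨fun i j => abs_zero.trans_le hR, fun i => abs_zero.trans_le hR⟩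

/-- The representatives of the finite covers at the scales `1/(j+1)`, taken together over all `j`.
-/
lemma exists_countable_dense_neuralClass {d L N : ℕ} {R r : ℝ} {ρ ρ₁ ρ₂ : ℝ → ℝ}
    (hρ : SmoothActivation ρ ρ₁ ρ₂) (hd : 1 ≤ d) (hN : 1 ≤ N) (hL : 1 ≤ L) (hR : 1 ≤ R)
    (hr : 0 ≤ r) :
    ∃ U₀ : Set (neuralClass ρ d L N R), U₀.Countable ∧ ∀ u : neuralClass ρ d L N R, ∀ η > 0, ∃ u₀ ∈ U₀,
      ∀ x ∈ Metric.closedBall (0 : EuclideanSpace ℝ (Fin d)) r,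
        |u.1 x - u₀.1 x| ≤ η ∧ |Δ u.1 x - Δ u₀.1 x| ≤ η := by
  have key : ∀ j : ℕ, ∃ V : Set (neuralClass ρ d L N R), V.Countable ∧ ∀ u : neuralClass ρ d L N R, ∃ u₀ ∈ V,
      ∀ x ∈ Metric.closedBall (0 : EuclideanSpace ℝ (Fin d)) r,
        |u.1 x - u₀.1 x| ≤ 1 / (j + 1) ∧ |Δ u.1 x - Δ u₀.1 x| ≤ 1 / (j + 1) := by
    intro j
    obtain ⟨κ, hκ, Φ, -, hΦ⟩ := exists_cover_neuralClass (L := L) (η := 1 / ((j : ℝ) + 1)) hρ hd hN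
      hL hR hr (by positivity) (by rw [div_le_one (by positivity)]; simp)
    choose rep hrep using fun c : Set.range Φ => c.2
    exact ⟨Set.range rep, Set.countable_range rep, fun u =>
      ⟨rep ⟨Φ u, u, rfl⟩, ⟨_, rfl⟩, hΦ _ _ (hrep ⟨Φ u, u, rfl⟩).symm⟩⟩
  choose V hV1 hV2 using key
  refine ⟨⋃ j, V j, Set.countable_iUnion hV1, fun u η hη => ?_⟩
  obtain ⟨j, hj⟩ := exists_nat_one_div_lt hη
  obtain ⟨u₀, h0, h1⟩ := hV2 j u
  exact ⟨u₀, Set.mem_iUnion.2 ⟨j, h0⟩, fun x hx =>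
    ⟨(h1 x hx).1.trans hj.le, (h1 x hx).2.trans hj.le⟩⟩

/-- This bound holds for every sample, including those with points outside `D`. Hence a bound on the
class at each point of the space is required, not only on `D`. -/
lemma exists_bound_monteCarloError {E ι : Type*} [MeasurableSpace E] {μ : Measure E}
    [IsProbabilityMeasure μ] {n : ℕ} {ψ : ι → E → ℝ} {f : E → ℝ} {B F : ℝ} {D : Set E}
    (hD : ∀ᵐ x ∂μ, x ∈ D) (hfF : ∀ᵐ x ∂μ, |f x| ≤ F) (hB : ∀ u, ∀ x ∈ D, |ψ u x| ≤ B)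
    (hb : ∀ x, ∃ b, ∀ u, |ψ u x| ≤ b) (x : Fin n → E) :
    ∃ M, ∀ u, |monteCarloError μ (fun x => (ψ u x - f x) ^ 2) x| ≤ M := by
  choose b hb using hb
  refine ⟨(B + F) ^ 2 + (n : ℝ)⁻¹ * ∑ i, (b (x i) + |f (x i)|) ^ 2, fun u => ?_⟩
  refine (abs_sub _ _).trans (add_le_add ?_ ?_)
  · rw [← Real.norm_eq_abs]
    refine (norm_integral_le_of_norm_le_const (μ := μ) (C := (B + F) ^ 2) ?_).trans_eq
      (by rw [probReal_univ, mul_one])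
    filter_upwards [hD, hfF] with y h1 h2
    have := sub_sq_mem_Icc (hB u y h1) h2
    rw [Real.norm_eq_abs, abs_of_nonneg this.1]
    exact this.2
  · rw [abs_of_nonneg (mul_nonneg (by positivity) (Finset.sum_nonneg fun i _ => sq_nonneg _))]
    refine mul_le_mul_of_nonneg_left (Finset.sum_le_sum fun i _ => ?_) (by positivity)
    exact (sub_sq_mem_Icc (hb (x i) u) le_rfl).2

/-- With `B` the Laplacian bound, `B + F ≤ BQ`, and `B²` carries `N^{4L - 4}`; the entropy factor
`√N` raises the exponent to `4L - 7/2`. The power `Q⁴` consists of `Q²` from this step and `d² ≤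
Q²`. -/
lemma sq_laplacian_bound_mul_sqrt_le {d L N : ℕ} {R F Q : ℝ} (hd : 1 ≤ d) (hN : 1 ≤ N)
    (hL : 1 ≤ L) (hR : 1 ≤ R) (hF : 0 ≤ F) (hQ : 1 + d + F ≤ Q) :
    1 ≤ d * (16 ^ L * (N * R) ^ (2 * L) / (N : ℝ) ^ 2) ∧
    (d * (16 ^ L * (N * R) ^ (2 * L) / (N : ℝ) ^ 2) + F) ^ 2 * √N ≤
      256 ^ L * Q ^ 4 * ((N : ℝ) ^ (4 * (L : ℝ) - 7 / 2) * R ^ (4 * L)) := by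
  have hN' : (1 : ℝ) ≤ N := by exact_mod_cast hN
  have hd' : (1 : ℝ) ≤ d := by exact_mod_cast hd
  have hNR : (N : ℝ) ≤ N * R := le_mul_of_one_le_right (by linarith) hR
  set B := d * (16 ^ L * (N * R) ^ (2 * L) / (N : ℝ) ^ 2) with hB
  have hB1 : 1 ≤ B := by
    refine one_le_mul_of_one_le_of_one_le hd' ?_
    rw [le_div_iff₀ (by positivity), one_mul]
    calc (N : ℝ) ^ 2 ≤ (N * R) ^ 2 := by gcongr
      _ ≤ (N * R) ^ (2 * L) := pow_le_pow_right₀ (by linarith) (by omega)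
      _ ≤ 16 ^ L * (N * R) ^ (2 * L) :=
        le_mul_of_one_le_left (by positivity) (one_le_pow₀ (by norm_num))
  refine ⟨hB1, ?_⟩
  have h1 : B + F ≤ B * Q := by nlinarith
  have hpow : (N : ℝ) ^ (4 * (L : ℝ) - 7 / 2) = (N : ℝ) ^ (4 * L) / (N : ℝ) ^ 4 * √N := by
    rw [show 4 * (L : ℝ) - 7 / 2 = ((4 * L : ℕ) : ℝ) - ((4 : ℕ) : ℝ) + 1 / 2 by push_cast; ring,
      Real.rpow_add (by linarith), Real.rpow_sub (by linarith), Real.rpow_natCast,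
      Real.rpow_natCast, Real.sqrt_eq_rpow]
  have h256 : (256 : ℝ) ^ L = (16 ^ L) ^ 2 := by rw [← pow_mul, mul_comm, pow_mul]; norm_num
  calc (B + F) ^ 2 * √N ≤ (B * Q) ^ 2 * √N := by gcongr
    _ = d ^ 2 * (256 ^ L * Q ^ 2 * ((N : ℝ) ^ (4 * (L : ℝ) - 7 / 2) * R ^ (4 * L))) := by
      rw [hB, hpow, h256]
      ring
    _ ≤ Q ^ 2 * (256 ^ L * Q ^ 2 * ((N : ℝ) ^ (4 * (L : ℝ) - 7 / 2) * R ^ (4 * L))) := by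
      gcongr
      linarith
    _ = _ := by ring

lemma sq_value_bound_mul_sqrt_le {N : ℕ} {R r G Q : ℝ} (hN : 1 ≤ N) (hR : 1 ≤ R) (hr : 0 ≤ r)
    (hG : 0 ≤ G) (hQ : 1 + r + G ≤ Q) :
    1 ≤ N * R * (1 + r) ∧
    (N * R * (1 + r) + G) ^ 2 * √N ≤ Q ^ 2 * (R ^ 2 * (N : ℝ) ^ (5 / 2 : ℝ)) := by
  have hN' : (1 : ℝ) ≤ N := by exact_mod_cast hN
  have hNR : 1 ≤ N * R := one_le_mul_of_one_le_of_one_le hN' hR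
  refine ⟨one_le_mul_of_one_le_of_one_le hNR (by linarith), ?_⟩
  have h1 : N * R * (1 + r) + G ≤ N * R * Q := by nlinarith
  have hpow : (N : ℝ) ^ (5 / 2 : ℝ) = (N : ℝ) ^ 2 * √N := by
    rw [show (5 / 2 : ℝ) = ((2 : ℕ) : ℝ) + 1 / 2 by norm_num, Real.rpow_add (by linarith),
      Real.rpow_natCast, Real.sqrt_eq_rpow]
  calc (N * R * (1 + r) + G) ^ 2 * √N ≤ (N * R * Q) ^ 2 * √N := by gcongr
    _ = _ := by rw [hpow]; ring

/-- Since `M ≥ 1`, the discretisation term, linear in `M`, can be put under the same factor `M²` as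
the sampling term. -/
lemma le_mul_of_majorant_bound {I M k y b a q σ V : ℝ} (hM : 1 ≤ M) (hk : 0 ≤ 1 / k) (hb : 0 ≤ b)
    (ha : 0 ≤ a) (hσ : 0 ≤ σ) (hI : I ≤ 4 * M * (1 / k) + M ^ 2 * y)
    (hy : 4 * (1 / k) + y ≤ b * (a * q * σ)) (hV : M ^ 2 * q ≤ V) : I ≤ V * (b * (a * σ)) := by
  have h1 : M ≤ M ^ 2 := le_self_pow₀ hM (by norm_num)
  have h2 : M * (1 / k) ≤ M ^ 2 * (1 / k) := mul_le_mul_of_nonneg_right h1 hk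
  have h3 := mul_le_mul_of_nonneg_left hy (sq_nonneg M)
  have h4 := mul_le_mul_of_nonneg_right hV (mul_nonneg hb (mul_nonneg ha hσ))
  linarith

-- Here the constant is still exponential in `L`. It is the product of the entropy factor `20 ·
-- 3^(L+1) · Q` and the size factor `256^L · Q⁴` of the interior term; the boundary term is smaller
-- in both and is enlarged to match.
set_option maxHeartbeats 400000 in
theorem statError_bounds {ρ ρ₁ ρ₂ : ℝ → ℝ} (hρ : SmoothActivation ρ ρ₁ ρ₂) {d L N n m : ℕ}
    {R α r : ℝ} (hd : 1 ≤ d) (hL : 1 ≤ L) (hN : 1 ≤ N) (hR : 1 ≤ R) (hn : 1 ≤ n) (hm : 1 ≤ m)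
    (hα : 0 < α) (hr : 0 ≤ r) (hn2 : 2 ≤ (N : ℝ) * R * n) (hm2 : 2 ≤ (N : ℝ) * R * m)
    {Ω : Set (EuclideanSpace ℝ (Fin d))} (hΩ : IsOpen Ω) (hΩr : Ω ⊆ Metric.closedBall 0 r)
    {f g : EuclideanSpace ℝ (Fin d) → ℝ} (hf : MemLp f ∞ (volume.restrict Ω))
    (hg : MemLp g ∞ ((surfaceMeasure d).restrict (frontier Ω)))
    {S : Type*} [MeasurableSpace S] (P : Measure S) [IsProbabilityMeasure P]
    {X : Fin n → S → EuclideanSpace ℝ (Fin d)} {Y : Fin m → S → EuclideanSpace ℝ (Fin d)}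
    (hX : ∀ i, Measurable (X i)) (hY : ∀ j, Measurable (Y j))
    (hXi : iIndepFun X P) (hYi : iIndepFun Y P) (hXu : ∀ i, pdf.IsUniform (X i) Ω P volume)
    (hYu : ∀ j, pdf.IsUniform (Y j) (frontier Ω) P (surfaceMeasure d)) {Q : ℝ}
    (hQ : Q = 1 + d + r + supNorm f (volume.restrict Ω)
      + supNorm g ((surfaceMeasure d).restrict (frontier Ω))) {c : ℝ}
    (hc : c = 60 * 768 ^ L * Q ^ 5 *
      (volume.real Ω + α * (surfaceMeasure d).real (frontier Ω)) * statRate L N R n m) :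
    let U := neuralClass ρ d L N R
    let loss := continuousLoss Ω α f g
    let empLoss := fun s : S => empiricalLoss Ω α f g (fun i => X i s) (fun j => Y j s)
    (∀ s, BddAbove (Set.range fun u : U => |loss u - empLoss s u|)) ∧
    (Integrable (fun s => statError U loss (empLoss s)) P ∧
      ∫ s, statError U loss (empLoss s) ∂P ≤ c) ∧
    (Integrable (fun s => statErrorTwoSided U loss (empLoss s)) P ∧
      ∫ s, statErrorTwoSided U loss (empLoss s) ∂P ≤ 2 * c) := by
  intro U loss empLoss
  have hne : Nonempty U := neuralClass_nonempty hL (by linarith)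
  have hR0 : 0 ≤ R := by linarith
  set F := supNorm f (volume.restrict Ω) with hF
  set G := supNorm g ((surfaceMeasure d).restrict (frontier Ω)) with hG
  have hF0 : 0 ≤ F := ENNReal.toReal_nonneg
  have hG0 : 0 ≤ G := ENNReal.toReal_nonneg
  set w₁ := volume.real Ω with hw₁
  set w₂ := (surfaceMeasure d).real (frontier Ω) with hw₂
  have hw₁0 : 0 ≤ w₁ := measureReal_nonneg
  have hw₂0 : 0 ≤ w₂ := measureReal_nonneg
  have := isProbabilityMeasure_cond_of_isUniform (hX ⟨0, hn⟩) (hXu ⟨0, hn⟩)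
  have := isProbabilityMeasure_cond_of_isUniform (hY ⟨0, hm⟩) (hYu ⟨0, hm⟩)
  obtain ⟨hΩ0, hΩt⟩ := measure_ne_zero_and_ne_top_of_isUniform (hX ⟨0, hn⟩) (hXu ⟨0, hn⟩)
  obtain ⟨hfr0, hfrt⟩ := measure_ne_zero_and_ne_top_of_isUniform (hY ⟨0, hm⟩) (hYu ⟨0, hm⟩)
  set μ₁ := ProbabilityTheory.cond volume Ω with hμ₁
  set μ₂ := ProbabilityTheory.cond (surfaceMeasure d) (frontier Ω) with hμ₂
  have hfm : AEMeasurable f μ₁ := hf.aestronglyMeasurable.aemeasurable.smul_measure _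
  have hgm : AEMeasurable g μ₂ := hg.aestronglyMeasurable.aemeasurable.smul_measure _
  have hfF : ∀ᵐ x ∂μ₁, |f x| ≤ F := ae_cond_of_ae_restrict (ae_abs_le_supNorm hf)
  have hgG : ∀ᵐ x ∂μ₂, |g x| ≤ G := ae_cond_of_ae_restrict (ae_abs_le_supNorm hg)
  set D := Metric.closedBall (0 : EuclideanSpace ℝ (Fin d)) r with hDdef
  have hD₁ : ∀ᵐ x ∂μ₁, x ∈ D :=
    ae_cond_of_ae_restrict (ae_restrict_of_forall_mem hΩ.measurableSet fun x hx => hΩr hx)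
  have hfrD : frontier Ω ⊆ D :=
    frontier_subset_closure.trans (closure_minimal hΩr Metric.isClosed_closedBall)
  have hD₂ : ∀ᵐ x ∂μ₂, x ∈ D :=
    ae_cond_of_ae_restrict (ae_restrict_of_forall_mem isClosed_frontier.measurableSet
      fun x hx => hfrD hx)
  let ψ₁ : U → EuclideanSpace ℝ (Fin d) → ℝ := fun u x => -(Δ u.1 x)
  let ψ₂ : U → EuclideanSpace ℝ (Fin d) → ℝ := fun u x => u.1 x
  have hcd : ∀ u : U, ContDiff ℝ 2 u.1 := fun u => contDiff_of_mem_neuralClass hρ hN hL hR0 u.2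
  have hψ₁ : ∀ u, Measurable (ψ₁ u) := fun u => (continuous_laplacian (hcd u)).neg.measurable
  have hψ₂ : ∀ u, Measurable (ψ₂ u) := fun u => (hcd u).continuous.measurable
  obtain ⟨hB₁1, hB₁Q⟩ := sq_laplacian_bound_mul_sqrt_le (Q := Q) hd hN hL hR hF0 (by linarith)
  obtain ⟨hB₂1, hB₂Q⟩ := sq_value_bound_mul_sqrt_le (Q := Q) hN hR hr hG0
    (by linarith [show (0 : ℝ) ≤ d by positivity])
  have hΔ : ∀ u x, |ψ₁ u x| ≤ d * (16 ^ L * (N * R) ^ (2 * L) / (N : ℝ) ^ 2) := fun u x =>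
    (abs_neg _).trans_le (abs_laplacian_le_of_mem_neuralClass hρ hN hL hR u.2 x)
  have hval : ∀ u x, |ψ₂ u x| ≤ N * R * (1 + ‖x‖) := fun u x =>
    abs_le_of_mem_neuralClass hρ hN hL hR0 u.2 x
  set B₁ := d * (16 ^ L * (N * R) ^ (2 * L) / (N : ℝ) ^ 2) with hB₁
  set B₂ := N * R * (1 + r) with hB₂
  have hval' : ∀ u, ∀ x ∈ D, |ψ₂ u x| ≤ B₂ := by
    intro u x hx
    have hx' : ‖x‖ ≤ r := by simpa [hDdef] using hx
    refine (hval u x).trans ?_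
    rw [hB₂]
    gcongr
  let err₁ : U → S → ℝ := fun u s => monteCarloError μ₁ (fun x => (ψ₁ u x - f x) ^ 2) fun i => X i s
  let err₂ : U → S → ℝ := fun u s => monteCarloError μ₂ (fun x => (ψ₂ u x - g x) ^ 2) fun j => Y j s
  have hdecomp : ∀ (s : S) (u : U), loss u - empLoss s u = w₁ * err₁ u s + α * w₂ * err₂ u s := by
    intro s u
    have h1 := real_mul_monteCarloError hΩ0 hΩt (fun x => (ψ₁ u x - f x) ^ 2) fun i => X i s
    have h2 := real_mul_monteCarloError hfr0 hfrt (fun x => (ψ₂ u x - g x) ^ 2) fun j => Y j s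
    simp only [loss, empLoss, continuousLoss, empiricalLoss, err₁, err₂]
    linear_combination -h1 - α * h2
  have hm₁ : ∀ u, AEMeasurable (err₁ u) P := fun u =>
    aemeasurable_monteCarloError hX hXu (((hψ₁ u).aemeasurable.sub hfm).pow_const 2)
  have hm₂ : ∀ u, AEMeasurable (err₂ u) P := fun u =>
    aemeasurable_monteCarloError hY hYu (((hψ₂ u).aemeasurable.sub hgm).pow_const 2)
  have hstab₁ := ae_abs_monteCarloError_sub_le hX hXu hψ₁ hfm hD₁ hfF fun u x _ => hΔ u x
  have hstab₂ := ae_abs_monteCarloError_sub_le hY hYu hψ₂ hgm hD₂ hgG hval'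
  have hbdd : ∀ s, BddAbove (Set.range fun u : U => |loss u - empLoss s u|) := by
    intro s
    obtain ⟨M₁, hM₁⟩ := exists_bound_monteCarloError hD₁ hfF (fun u x _ => hΔ u x)
      (fun x => ⟨_, fun u => hΔ u x⟩) fun i => X i s
    obtain ⟨M₂, hM₂⟩ := exists_bound_monteCarloError hD₂ hgG hval'
      (fun x => ⟨_, fun u => hval u x⟩) fun j => Y j s
    refine ⟨w₁ * M₁ + α * w₂ * M₂, ?_⟩
    rintro _ ⟨u, rfl⟩
    simp only [hdecomp]
    refine (abs_add_le _ _).trans (add_le_add ?_ ?_)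
    · rw [abs_mul, abs_of_nonneg hw₁0]
      exact mul_le_mul_of_nonneg_left (hM₁ u) hw₁0
    · rw [abs_mul, abs_of_nonneg (by positivity : 0 ≤ α * w₂)]
      exact mul_le_mul_of_nonneg_left (hM₂ u) (by positivity)
  obtain ⟨U₀, hU₀, hdense⟩ := exists_countable_dense_neuralClass (L := L) hρ hd hN hL hR hr
  have happ : ∀ᵐ s ∂P, ∀ u : U, ∀ ε > 0, ∃ u₀ ∈ U₀,
      |(loss u - empLoss s u) - (loss u₀ - empLoss s u₀)| ≤ ε := by
    filter_upwards [hstab₁, hstab₂] with s hs₁ hs₂ u ε hε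
    -- The Lipschitz constant of the total error with respect to `u`, increased by one to allow
    -- division.
    set K := w₁ * (4 * (B₁ + F)) + α * w₂ * (4 * (B₂ + G)) + 1 with hK
    have hK0 : 0 < K := by positivity
    obtain ⟨u₀, hu₀, h⟩ := hdense u (ε / K) (by positivity)
    refine ⟨u₀, hu₀, ?_⟩
    have e1 := hs₁ u u₀ (ε / K) (by positivity) fun x hx => by
      have := (h x hx).2
      rw [← abs_neg] at this
      convert this using 2
      simp only [ψ₁]
      ring
    have e2 := hs₂ u u₀ (ε / K) (by positivity) fun x hx => (h x hx).1
    rw [hdecomp, hdecomp]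
    have : w₁ * err₁ u s + α * w₂ * err₂ u s - (w₁ * err₁ u₀ s + α * w₂ * err₂ u₀ s) =
        w₁ * (err₁ u s - err₁ u₀ s) + α * w₂ * (err₂ u s - err₂ u₀ s) := by ring
    rw [this]
    calc |w₁ * (err₁ u s - err₁ u₀ s) + α * w₂ * (err₂ u s - err₂ u₀ s)|
        ≤ w₁ * |err₁ u s - err₁ u₀ s| + α * w₂ * |err₂ u s - err₂ u₀ s| := by
          refine (abs_add_le _ _).trans_eq ?_
          rw [abs_mul, abs_mul, abs_of_nonneg hw₁0, abs_of_nonneg (by positivity : 0 ≤ α * w₂)]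
      _ ≤ w₁ * (4 * (B₁ + F) * (ε / K)) + α * w₂ * (4 * (B₂ + G) * (ε / K)) := by gcongr
      _ = (K - 1) * (ε / K) := by rw [hK]; ring
      _ ≤ K * (ε / K) := by gcongr; linarith
      _ = ε := by field_simp
  -- Interior and boundary use separate covers, at the scales `1/n` and `1/m`, so that each half of
  -- the rate involves only its own sample size.
  have hcov : ∀ {k : ℕ}, 1 ≤ k → _ := fun {k} hk =>
    exists_cover_neuralClass (L := L) (N := N) (R := R) (η := 1 / (k : ℝ)) hρ hd hN hL hR hr
      (by positivity) (by rw [div_le_one (by positivity)]; exact_mod_cast hk)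
  obtain ⟨κ₁, _, Φ₁, hcard₁, hΦ₁⟩ := hcov hn
  obtain ⟨κ₂, _, Φ₂, hcard₂, hΦ₂⟩ := hcov hm
  have hK₁ : (1 : ℝ) ≤ Fintype.card κ₁ := by
    have : 1 ≤ Fintype.card κ₁ := Fintype.card_pos_iff.2 ⟨Φ₁ (Classical.arbitrary U)⟩
    exact_mod_cast this
  have hK₂ : (1 : ℝ) ≤ Fintype.card κ₂ := by
    have : 1 ≤ Fintype.card κ₂ := Fintype.card_pos_iff.2 ⟨Φ₂ (Classical.arbitrary U)⟩
    exact_mod_cast this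
  obtain ⟨T₁, hT₁i, hT₁, hT₁le⟩ := exists_majorant_monteCarloError hn hX hXi hXu hψ₁ hfm hD₁ hfF
    (fun u x _ => hΔ u x) (by linarith) hF0 (Φ := Φ₁) (η := 1 / (n : ℝ)) (by positivity) (by
      intro u u' huu x hx
      have := (hΦ₁ u u' huu x hx).2
      rw [← abs_neg] at this
      convert this using 2
      simp only [ψ₁]
      ring)
  obtain ⟨T₂, hT₂i, hT₂, hT₂le⟩ := exists_majorant_monteCarloError hm hY hYi hYu hψ₂ hgm hD₂ hgG
    hval' (by linarith) hG0 (Φ := Φ₂) (η := 1 / (m : ℝ)) (by positivity)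
    (fun u u' huu x hx => (hΦ₂ u u' huu x hx).1)
  have hQ2 : 2 ≤ Q := by
    have : (1 : ℝ) ≤ d := by exact_mod_cast hd
    linarith
  have hs₁ := sqrt_log_card_div_add_le (Q := Q) hd hN hR hn hr (by linarith) hn2 hK₁ hcard₁
  have hs₂ := sqrt_log_card_div_add_le (Q := Q) hd hN hR hm hr (by linarith) hm2 hK₂ hcard₂
  set sn := √(Real.log R) + √(Real.log N) + √(Real.log n) with hsn
  set sm := √(Real.log R) + √(Real.log N) + √(Real.log m) with hsm
  have h768 : (768 : ℝ) ^ L = 3 ^ L * 256 ^ L := by rw [← mul_pow]; norm_num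
  have hT₁c : ∫ s, T₁ s ∂P ≤ 60 * 768 ^ L * Q ^ 5 * ((n : ℝ) ^ (-(1 / 2) : ℝ)
      * (N : ℝ) ^ (4 * (L : ℝ) - 7 / 2) * R ^ (4 * L) * sn) := by
    refine (le_mul_of_majorant_bound (by linarith) (by positivity) (by positivity) (by positivity)
      (by positivity) hT₁le hs₁ hB₁Q).trans_eq ?_
    rw [h768]
    ring
  have hT₂c : ∫ s, T₂ s ∂P ≤ 60 * 768 ^ L * Q ^ 5 * ((m : ℝ) ^ (-(1 / 2) : ℝ) * R ^ 2
      * (N : ℝ) ^ (5 / 2 : ℝ) * sm) := by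
    refine (le_mul_of_majorant_bound (by linarith) (by positivity) (by positivity) (by positivity)
      (by positivity) hT₂le hs₂ hB₂Q).trans ?_
    set a₂ := (m : ℝ) ^ (-(1 / 2) : ℝ) * R ^ 2 * (N : ℝ) ^ (5 / 2 : ℝ) * sm with ha₂
    have ha₂0 : 0 ≤ a₂ := by positivity
    calc _ = 60 * 3 ^ L * Q ^ 3 * a₂ := by rw [ha₂]; ring
      _ ≤ 60 * 768 ^ L * Q ^ 5 * a₂ := by
        refine mul_le_mul_of_nonneg_right (mul_le_mul ?_ ?_ (by positivity) (by positivity)) ha₂0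
        · exact mul_le_mul_of_nonneg_left (pow_le_pow_left₀ (by norm_num) (by norm_num) L)
            (by norm_num)
        · exact pow_le_pow_right₀ (by linarith) (by norm_num)
  have hfinal := integrable_statError_and_integral_le (U := U) (loss := loss) (emp := empLoss)
    (P := P) (T := fun s => w₁ * T₁ s + α * w₂ * T₂ s)
    (fun u => by
      simp only [hdecomp]
      exact ((hm₁ u).const_mul _).add ((hm₂ u).const_mul _))
    hU₀ happ hbdd ((hT₁i.const_mul _).add (hT₂i.const_mul _)) (by
      filter_upwards [hT₁, hT₂] with s h1 h2 u
      rw [hdecomp]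
      refine (abs_add_le _ _).trans (add_le_add ?_ ?_)
      · rw [abs_mul, abs_of_nonneg hw₁0]
        exact mul_le_mul_of_nonneg_left (h1 u) hw₁0
      · rw [abs_mul, abs_of_nonneg (by positivity : 0 ≤ α * w₂)]
        exact mul_le_mul_of_nonneg_left (h2 u) (by positivity))
  have hTc : ∫ s, (w₁ * T₁ s + α * w₂ * T₂ s) ∂P ≤ c := by
    rw [integral_add (hT₁i.const_mul _) (hT₂i.const_mul _), integral_const_mul, integral_const_mul]
    set a₁ := (n : ℝ) ^ (-(1 / 2) : ℝ) * (N : ℝ) ^ (4 * (L : ℝ) - 7 / 2) * R ^ (4 * L) * sn with ha₁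
    set a₂ := (m : ℝ) ^ (-(1 / 2) : ℝ) * R ^ 2 * (N : ℝ) ^ (5 / 2 : ℝ) * sm with ha₂
    have ha₁0 : 0 ≤ a₁ := by positivity
    have ha₂0 : 0 ≤ a₂ := by positivity
    have hrate : statRate L N R n m = a₁ + a₂ := rfl
    calc w₁ * ∫ s, T₁ s ∂P + α * w₂ * ∫ s, T₂ s ∂P
        ≤ w₁ * (60 * 768 ^ L * Q ^ 5 * (a₁ + a₂)) + α * w₂ * (60 * 768 ^ L * Q ^ 5 * (a₁ + a₂)) := by
          gcongr
          · refine hT₁c.trans ?_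
            gcongr
            linarith
          · refine hT₂c.trans ?_
            gcongr
            linarith
      _ = c := by rw [hc, hrate]; ring
  exact ⟨hbdd, ⟨hfinal.1.1, hfinal.1.2.trans hTc⟩, hfinal.2.1, hfinal.2.2.trans (by linarith)⟩

/-- Exchanging base and exponent, `a^(c₀ log(d+3)) = (d+3)^(c₀ log a)`, and `d + 3 ≤ Q³` because `Q
≥ 2`. This turns exponential dependence on depth into polynomial dependence on the dimension. -/
lemma pow_le_pow_of_le_log {a c₀ Q : ℝ} {d L : ℕ} (ha : 1 ≤ a) (hL : (L : ℝ) ≤ c₀ * Real.log (d + 3))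
    (hQ2 : 2 ≤ Q) (hdQ : d ≤ Q) : a ^ L ≤ Q ^ (3 * ⌈c₀ * Real.log a⌉₊) := by
  have ha0 : 0 < a := by linarith
  have hd3 : (0 : ℝ) < d + 3 := by positivity
  have hlog := Real.log_nonneg ha
  have h1 : a ^ L ≤ ((d : ℝ) + 3) ^ (c₀ * Real.log a) := by
    rw [← Real.rpow_natCast, Real.rpow_def_of_pos ha0, Real.rpow_def_of_pos hd3, Real.exp_le_exp]
    nlinarith [mul_le_mul_of_nonneg_left hL hlog]
  have h2 : ((d : ℝ) + 3) ^ (c₀ * Real.log a) ≤ ((d : ℝ) + 3) ^ ⌈c₀ * Real.log a⌉₊ := by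
    rw [← Real.rpow_natCast]
    exact Real.rpow_le_rpow_of_exponent_le (by linarith) (Nat.le_ceil _)
  have h3 : (d : ℝ) + 3 ≤ Q ^ 3 := by nlinarith [mul_self_nonneg (Q - 2)]
  rw [pow_mul]
  exact (h1.trans h2).trans (pow_le_pow_left₀ hd3.le h3 _)

end

theorem lemma5p7 (c₀ : ℝ) (hc₀ : 0 < c₀) :
    ∃ (C : ℝ) (k : ℕ), 0 < C ∧
      ∀ (ρ : ℝ → ℝ), (ρ = Real.tanh ∨ ρ = Real.sigmoid) →
      ∀ (d L N n m : ℕ) (R α r : ℝ),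
        1 ≤ d → 2 ≤ L → (L : ℝ) ≤ c₀ * Real.log (d + 3) →
        1 ≤ N → 1 ≤ R → 1 ≤ n → 1 ≤ m → 0 < α → 0 ≤ r →
        2 ≤ (N : ℝ) * R * (min n m : ℕ) →
      ∀ (Ω : Set (EuclideanSpace ℝ (Fin d))), IsOpen Ω → Ω ⊆ Metric.closedBall 0 r →
      ∀ (f g : EuclideanSpace ℝ (Fin d) → ℝ),
        MemLp f ∞ (volume.restrict Ω) →
        MemLp g ∞ ((surfaceMeasure d).restrict (frontier Ω)) →
      ∀ {S : Type*} [MeasurableSpace S] (P : Measure S) [IsProbabilityMeasure P]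
        (X : Fin n → S → EuclideanSpace ℝ (Fin d)) (Y : Fin m → S → EuclideanSpace ℝ (Fin d)),
        (∀ i, Measurable (X i)) → (∀ j, Measurable (Y j)) →
        iIndepFun X P → iIndepFun Y P →
        (∀ i, pdf.IsUniform (X i) Ω P volume) →
        (∀ j, pdf.IsUniform (Y j) (frontier Ω) P (surfaceMeasure d)) →
      let U := neuralClass ρ d L N R
      let loss := continuousLoss Ω α f g
      let empLoss := fun s : S => empiricalLoss Ω α f g (fun i => X i s) (fun j => Y j s)
      let c := C * (1 + d + r + supNorm f (volume.restrict Ω)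
          + supNorm g ((surfaceMeasure d).restrict (frontier Ω))) ^ k
          * (volume.real Ω + α * (surfaceMeasure d).real (frontier Ω))
      (∀ s, BddAbove (Set.range fun u : U => |loss u - empLoss s u|)) ∧
      (Integrable (fun s => statError U loss (empLoss s)) P ∧
        ∫ s, statError U loss (empLoss s) ∂P ≤ c * statRate L N R n m) ∧
      (Integrable (fun s => statErrorTwoSided U loss (empLoss s)) P ∧
        ∫ s, statErrorTwoSided U loss (empLoss s) ∂P ≤ c * statRate L N R n m) := by
  -- The constant is twice `60`, for the two-sided version. The exponent is `5` from the powers of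
  -- `Q` already present, plus what absorbs `768^L`.
  refine ⟨120, 3 * ⌈c₀ * Real.log 768⌉₊ + 5, by norm_num, ?_⟩
  intro ρ hρ d L N n m R α r hd hL hLd hN hR hn hm hα hr h2 Ω hΩ hΩr f g hf hg S _ P _ X Y hX hY
    hXi hYi hXu hYu U loss empLoss c
  obtain ⟨ρ₁, ρ₂, hsmooth⟩ : ∃ ρ₁ ρ₂, SmoothActivation ρ ρ₁ ρ₂ := by
    rcases hρ with rfl | rfl
    · exact ⟨_, _, smoothActivation_tanh⟩
    · exact ⟨_, _, smoothActivation_sigmoid⟩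
  have hn2 : 2 ≤ (N : ℝ) * R * n := h2.trans (by gcongr; exact min_le_left _ _)
  have hm2 : 2 ≤ (N : ℝ) * R * m := h2.trans (by gcongr; exact min_le_right _ _)
  obtain ⟨h1, ⟨h3, h4⟩, h5, h6⟩ := statError_bounds hsmooth hd (show 1 ≤ L by omega) hN hR hn hm hα hr hn2 hm2
    hΩ hΩr hf hg P hX hY hXi hYi hXu hYu rfl rfl
  set F := supNorm f (volume.restrict Ω) with hF
  set G := supNorm g ((surfaceMeasure d).restrict (frontier Ω)) with hG
  have hF0 : 0 ≤ F := ENNReal.toReal_nonneg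
  have hG0 : 0 ≤ G := ENNReal.toReal_nonneg
  have hd' : (1 : ℝ) ≤ d := by exact_mod_cast hd
  have hQ2 : 2 ≤ 1 + d + r + F + G := by linarith
  have hpow := pow_le_pow_of_le_log (a := 768) (Q := 1 + d + r + F + G) (by norm_num) hLd hQ2
    (by linarith)
  have hw : 0 ≤ volume.real Ω + α * (surfaceMeasure d).real (frontier Ω) := by positivity
  have hrate : 0 ≤ statRate L N R n m := by unfold statRate; positivity
  have key : 2 * (60 * 768 ^ L * (1 + d + r + F + G) ^ 5 *
      (volume.real Ω + α * (surfaceMeasure d).real (frontier Ω)) * statRate L N R n m) ≤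
      c * statRate L N R n m := by
    simp only [c]
    refine mul_le_mul_of_nonneg_right ?_ hrate |>.trans' (le_of_eq (mul_assoc _ _ _).symm)
    rw [← mul_assoc]
    refine mul_le_mul_of_nonneg_right ?_ hw
    rw [pow_add]
    have := mul_le_mul_of_nonneg_right hpow (by positivity : 0 ≤ (1 + d + r + F + G) ^ 5)
    linarith
  refine ⟨h1, ⟨h3, h4.trans (le_trans ?_ key)⟩, h5, h6.trans key⟩
  have : 0 ≤ 60 * 768 ^ L * (1 + d + r + F + G) ^ 5 *
      (volume.real Ω + α * (surfaceMeasure d).real (frontier Ω)) * statRate L N R n m := by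
    positivity
  linarith
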